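/- Let $\alpha\ge 0$, let $\mathbb K=[0,\infty)\times\mathbb R$ carry the measure $dm_\alpha(x,t)=\frac{1}{\pi\Gamma(\alpha+1)}x^{2\alpha+1}\,dx\,dt$, let $Q=2\alpha+4$ and $|(x,t)|=(x^4+4t^2)^{1/4}$. Write $L_m^\alpha$ for the generalized Laguerre polynomials, and for $(\lambda,m)\in\widehat{\mathbb K}=\mathbb R\times\mathbb N$ (with $0\in\mathbb N$) put $$\varphi_{(\lambda,m)}(x,t)=\frac{m!\,\Gamma(\alpha+1)}{\Gamma(m+\alpha+1)}\,e^{i\lambda t}e^{-|\lambda|x^2/2}L_m^\alpha(|\lambda|x^2),\qquad |(\lambda,m)|=4|\lambda|\Big(m+\frac{\alpha+1}{2}\Big).$$ Let $\widehat{\mathbb K}$ carry the measure $\gamma_\alpha$ given by $\int g\,d\gamma_\alpha=\sum_{m\ge0}L_m^\alpha(0)\int_{\mathbb R}g(\lambda,m)|\lambda|^{\alpha+1}\,d\lambda$. The Schwartz space $\mathcal S(\mathbb K)$ consists of the restrictions to $\mathbb K$ of the complex-valued Schwartz functions on $\mathbb R^2$ that are even in the first variable, and the Fourier–Laguerre transform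 of $f\in\mathcal S(\mathbb K)$ is $\hat f(\lambda,m)=\int_{\mathbb K}f\,\varphi_{(-\lambda,m)}\,dm_\alpha$. Norms of functions on $\mathbb K$ and on $\widehat{\mathbb K}$ are the Lebesgue norms with respect to $m_\alpha$ and $\gamma_\alpha$, with values in $[0,\infty]$. Let $2\le p<\infty$, $p'=p/(p-1)$, $0<a<Q/p$ and $0<b<4$. Then there is a constant $c>0$, depending only on $a,b,p,\alpha$, such that for every $f\in\mathcal S(\mathbb K)$ $$\|\hat f\|_p^{a+b}\le c\,\big\|\,|(x,t)|^a f\,\big\|_{p'}^{b}\,\big\|\,|(\lambda,m)|^{b/2}\hat f\,\big\|_p^{a}.$$ -/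

import Mathlib

open MeasureTheory

namespace LaguerreHypergroup

noncomputable section

/-- The generalized Laguerre polynomial
`L_m^α(x) = ∑_{k=0}^m (-1)^k Γ(m+α+1) / (Γ(k+α+1) k! (m-k)!) x^k`. -/
def laguerre (α : ℝ) (m : ℕ) (x : ℝ) : ℝ :=
  ∑ k ∈ Finset.range (m + 1),
    (-1) ^ k * Real.Gamma (m + α + 1) /
      (Real.Gamma (k + α + 1) * (k.factorial : ℝ) * ((m - k).factorial : ℝ)) * x ^ k

/-- The set `𝕂 = [0,∞) × ℝ`. -/
def carrier : Set (ℝ × ℝ) := Set.Ici 0 ×ˢ Set.univ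

/-- The measure `dm_α(x,t) = x^(2α+1) dx dt / (π Γ(α+1))` on `𝕂`, regarded as a measure on
`ℝ × ℝ` that vanishes outside `𝕂`. -/
def haar (α : ℝ) : Measure (ℝ × ℝ) :=
  ((volume : Measure (ℝ × ℝ)).restrict carrier).withDensity
    (fun z => ENNReal.ofReal (z.1 ^ (2 * α + 1) / (Real.pi * Real.Gamma (α + 1))))

/-- The homogeneous norm `|(x,t)| = (x⁴ + 4t²)^(1/4)` on `𝕂`. -/
def homNorm (z : ℝ × ℝ) : ℝ := (z.1 ^ 4 + 4 * z.2 ^ 2) ^ (1 / 4 : ℝ)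

/-- The homogeneous dimension `Q = 2α + 4`. -/
def homDim (α : ℝ) : ℝ := 2 * α + 4

/-- The Laguerre functions
`φ_(l,m)(x,t) = m! Γ(α+1) / Γ(m+α+1) * e^(i l t) e^(-|l|x²/2) L_m^α(|l|x²)`. -/
def phi (α : ℝ) (ξ : ℝ × ℕ) (z : ℝ × ℝ) : ℂ :=
  (((ξ.2.factorial : ℝ) * Real.Gamma (α + 1) / Real.Gamma (ξ.2 + α + 1) : ℝ) : ℂ) *
    Complex.exp (Complex.I * ξ.1 * z.2) *
    ((Real.exp (-(|ξ.1| * z.1 ^ 2 / 2)) * laguerre α ξ.2 (|ξ.1| * z.1 ^ 2) : ℝ) : ℂ)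

/-- The Fourier–Laguerre transform `f̂(l,m) = ∫_𝕂 f φ_(-l,m) dm_α`. -/
def transform (α : ℝ) (f : ℝ × ℝ → ℂ) (ξ : ℝ × ℕ) : ℂ :=
  ∫ z, f z * phi α (-ξ.1, ξ.2) z ∂(haar α)

/-- The Plancherel measure `dγ_α(l,m) = L_m^α(0) |l|^(α+1) dl` on the dual `ℝ × ℕ`
(Lebesgue measure in `l`, counting measure in `m`). -/
def plancherel (α : ℝ) : Measure (ℝ × ℕ) :=
  ((volume : Measure ℝ).prod (Measure.count : Measure ℕ)).withDensity
    (fun ξ => ENNReal.ofReal (laguerre α ξ.2 0 * |ξ.1| ^ (α + 1)))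

/-- The quasi-norm `|(l,m)| = 4|l|(m + (α+1)/2)` on the dual `ℝ × ℕ`. -/
def dualNorm (α : ℝ) (ξ : ℝ × ℕ) : ℝ := 4 * |ξ.1| * (ξ.2 + (α + 1) / 2)

/-- The Schwartz space of `𝕂`: the Schwartz functions on `ℝ × ℝ` that are even in the first
variable (equivalently, their restrictions to `𝕂`). -/
def schwartzSpace : Submodule ℂ (SchwartzMap (ℝ × ℝ) ℂ) where
  carrier := {f | ∀ x t : ℝ, f (-x, t) = f (x, t)}
  zero_mem' := fun _ _ => rfl
  add_mem' := fun {f g} hf hg x t => by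
    simp only [add_apply]
    rw [hf x t, hg x t]
  smul_mem' := fun c f hf x t => by
    simp only [smul_apply]
    rw [hf x t]

end

end LaguerreHypergroup

/-! Write `A` and `B` for the weighted norms of `f` and of its transform. The transform is cut at
dual radius `R`. Beyond `R`, inserting the weight costs `R ^ (-(b / 2))`, so that part is at most `R
^ (-(b / 2)) * B` (`eLpNorm_indicator_transform_compl_le`). Within `R`, the claim is a bound `C * R
^ (a / 2) * A` (`exists_eLpNorm_indicator_transform_le`); choosing `R` to balance the two terms then
gives the product inequality (`rpow_le_mul_of_forall_le`).

For the low frequencies, `f` itself is cut at the dual scale `r = R ^ (-1/2)`. The inner piece has a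
bounded transform, its `L¹` norm being controlled by Hölder because `|z| ^ (-a p)` is locally
integrable for `a p < Q`; the measure of the dual ball is `O(R ^ (Q / 2))`. The outer piece is
handled by Hausdorff–Young, the weight being at least `r ^ a` there.

Hausdorff–Young up to a constant (`exists_eLpNorm_transform_le`) is obtained by real interpolation
between two endpoints. The `L²` bound combines Plancherel in `t` with Bessel's inequality for the
Laguerre functions in `x`. The `L¹`–`L^∞` bound needs `|φ|` bounded uniformly in the degree
(`exists_norm_phi_le`); this is read off from the differential equation of `exp (-x/2) * L_m^α(x)`
by energy estimates, with the orthogonality norm as the only global input. -/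

namespace LaguerreHypergroup

/-! ### Laguerre polynomials: differential equation and growth of the value at the origin. -/

section

open Polynomial Set Filter Topology

/-- The coefficient of `x ^ k` in `L_m^α`, for `k ≤ m`. -/
noncomputable def laguerreCoeff (α : ℝ) (m k : ℕ) : ℝ :=
  (-1) ^ k * Real.Gamma (m + α + 1) /
    (Real.Gamma (k + α + 1) * (k.factorial : ℝ) * ((m - k).factorial : ℝ))

/-- The generalized Laguerre polynomial as an element of `ℝ[X]`. -/
noncomputable def laguerrePoly (α : ℝ) (m : ℕ) : ℝ[X] :=
  ∑ k ∈ Finset.range (m + 1), monomial k (laguerreCoeff α m k)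

theorem eval_laguerrePoly (α : ℝ) (m : ℕ) (x : ℝ) :
    (laguerrePoly α m).eval x = laguerre α m x := by
  simp [laguerrePoly, laguerre, laguerreCoeff, eval_finsetSum]

theorem continuous_laguerre (α : ℝ) (m : ℕ) : Continuous (laguerre α m) :=
  (laguerrePoly α m).continuous.congr (eval_laguerrePoly α m)

theorem coeff_laguerrePoly (α : ℝ) (m k : ℕ) :
    (laguerrePoly α m).coeff k = if k ≤ m then laguerreCoeff α m k else 0 := by
  simp only [laguerrePoly, finsetSum_coeff, coeff_monomial, Finset.sum_ite_eq',
    Finset.mem_range, Nat.lt_succ_iff]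

theorem Gamma_natCast_add_pos {α : ℝ} (hα : 0 ≤ α) (k : ℕ) : 0 < Real.Gamma (k + α + 1) :=
  Real.Gamma_pos_of_pos (by positivity)

theorem laguerreCoeff_succ {α : ℝ} (hα : 0 ≤ α) {m k : ℕ} (hk : k < m) :
    (k + 1) * (k + 1 + α) * laguerreCoeff α m (k + 1) = -(m - k) * laguerreCoeff α m k := by
  obtain ⟨j, rfl⟩ := Nat.exists_eq_add_of_lt hk
  have h1 : k + j + 1 - k = j + 1 := by omega
  have h2 : k + j + 1 - (k + 1) = j := by omega
  have hG : Real.Gamma ((k + 1 : ℕ) + α + 1) = (k + α + 1) * Real.Gamma (k + α + 1) := by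
    rw [← Real.Gamma_add_one (by positivity)]
    push_cast
    ring_nf
  have := (Gamma_natCast_add_pos hα k).ne'
  have h3 : (k : ℝ) + α + 1 ≠ 0 := by positivity
  simp only [laguerreCoeff, h1, h2, hG, Nat.factorial_succ, pow_succ]
  push_cast
  field_simp
  ring

/-- Comparing coefficients of `X ^ k` reduces this to the two-term recursion `laguerreCoeff_succ`,
which persists past the degree because the factor `m - k` vanishes at `k = m`. -/
theorem laguerrePoly_ode {α : ℝ} (hα : 0 ≤ α) (m : ℕ) :
    X * derivative (derivative (laguerrePoly α m)) +
      (C (α + 1) - X) * derivative (laguerrePoly α m) + C (m : ℝ) * laguerrePoly α m = 0 := by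
  ext k
  have key : ((k : ℝ) + 1) * (k + 1 + α) * (laguerrePoly α m).coeff (k + 1) =
      -(m - k) * (laguerrePoly α m).coeff k := by
    simp only [coeff_laguerrePoly]
    rcases lt_trichotomy k m with h | h | h
    · rw [if_pos (by omega), if_pos h.le]
      exact laguerreCoeff_succ hα h
    · subst h
      simp
    · rw [if_neg (by omega), if_neg (by omega)]
      simp
  cases k with
  | zero =>
    simp [sub_mul, coeff_derivative] at key ⊢
    linear_combination key
  | succ k =>
    simp [sub_mul, add_mul, coeff_derivative, coeff_X_mul, mul_assoc] at key ⊢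
    linear_combination key

theorem laguerre_zero (α : ℝ) (m : ℕ) :
    laguerre α m 0 = Real.Gamma (m + α + 1) / (Real.Gamma (α + 1) * m.factorial) := by
  rw [laguerre, Finset.sum_eq_single 0]
  · simp
  · intro k _ hk
    simp [hk]
  · simp

theorem laguerre_zero_succ {α : ℝ} (hα : 0 ≤ α) (m : ℕ) :
    laguerre α (m + 1) 0 = (1 + α / (m + 1)) * laguerre α m 0 := by
  have hG : Real.Gamma ((m + 1 : ℕ) + α + 1) = (m + α + 1) * Real.Gamma (m + α + 1) := by
    rw [← Real.Gamma_add_one (by positivity)]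
    push_cast
    ring_nf
  have := (Real.Gamma_pos_of_pos (show 0 < α + 1 by positivity)).ne'
  rw [laguerre_zero, laguerre_zero, hG, Nat.factorial_succ]
  push_cast
  field_simp
  ring

theorem one_le_laguerre_zero {α : ℝ} (hα : 0 ≤ α) (m : ℕ) : 1 ≤ laguerre α m 0 := by
  induction m with
  | zero =>
    have := (Real.Gamma_pos_of_pos (show 0 < α + 1 by positivity)).ne'
    simp [laguerre_zero, this]
  | succ m ih =>
    rw [laguerre_zero_succ hα]
    have : 0 ≤ α / (m + 1) := by positivity
    nlinarith

theorem laguerre_zero_pos {α : ℝ} (hα : 0 ≤ α) (m : ℕ) : 0 < laguerre α m 0 :=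
  one_pos.trans_le (one_le_laguerre_zero hα m)

/-- The value at `0` is a product of factors `1 + α / j`, and each factor with `j ≥ 2` is at most
`(j / (j - 1)) ^ α`, so the product telescopes. -/
theorem laguerre_zero_succ_le {α : ℝ} (hα : 0 ≤ α) (m : ℕ) :
    laguerre α (m + 1) 0 ≤ (1 + α) * (m + 1 : ℝ) ^ α := by
  induction m with
  | zero =>
    have := (Real.Gamma_pos_of_pos (show 0 < α + 1 by positivity)).ne'
    rw [laguerre_zero_succ hα]
    simp [laguerre_zero, this]
  | succ m ih =>
    rw [laguerre_zero_succ hα]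
    have h1 : 1 + α / ((m : ℝ) + 2) ≤ (((m : ℝ) + 2) / (m + 1)) ^ α := by
      have h2 : Real.exp (1 / ((m : ℝ) + 2)) ≤ ((m : ℝ) + 2) / (m + 1) := by
        -- This is `1 + y ≤ exp y` at `y = -1 / (m + 2)`; inverting it gives the upper bound on
        -- `exp`.
        have h3 : ((m : ℝ) + 1) / (m + 2) ≤ Real.exp (-(1 / ((m : ℝ) + 2))) := by
          refine le_trans (le_of_eq ?_) (Real.add_one_le_exp _)
          field_simp
          ring
        rw [Real.exp_neg, le_inv_comm₀ (by positivity) (by positivity), inv_div] at h3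
        exact h3
      calc 1 + α / ((m : ℝ) + 2) ≤ Real.exp (1 / ((m : ℝ) + 2) * α) := by
            refine le_trans (le_of_eq ?_) (Real.add_one_le_exp _)
            ring
        _ = Real.exp (1 / ((m : ℝ) + 2)) ^ α := Real.exp_mul _ _
        _ ≤ _ := Real.rpow_le_rpow (by positivity) h2 hα
    push_cast
    have e : (m : ℝ) + 1 + 1 = m + 2 := by ring
    rw [e]
    calc (1 + α / ((m : ℝ) + 2)) * laguerre α (m + 1) 0
        ≤ (((m : ℝ) + 2) / (m + 1)) ^ α * ((1 + α) * (m + 1 : ℝ) ^ α) :=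
          mul_le_mul h1 ih (laguerre_zero_pos hα _).le (by positivity)
      _ = _ := by
        rw [Real.div_rpow (by positivity) (by positivity)]
        have : 0 < ((m : ℝ) + 1) ^ α := by positivity
        field_simp

theorem laguerre_zero_le {α : ℝ} (hα : 0 ≤ α) (m : ℕ) :
    laguerre α m 0 ≤ (1 + α) * 2 ^ α * (m + (α + 1) / 2) ^ α := by
  rw [mul_assoc, ← Real.mul_rpow (by positivity) (by positivity)]
  cases m with
  | zero =>
    have := (Real.Gamma_pos_of_pos (show 0 < α + 1 by positivity)).ne'
    have h0 : laguerre α 0 0 = 1 := by simp [laguerre_zero, this]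
    rw [h0]
    have : 1 ≤ (2 * (((0 : ℕ) : ℝ) + (α + 1) / 2)) ^ α := by
      apply Real.one_le_rpow _ hα
      push_cast
      linarith
    nlinarith
  | succ m =>
    refine (laguerre_zero_succ_le hα m).trans ?_
    gcongr
    push_cast
    linarith

end

/-! ### Energy estimates for the Laguerre differential equation. -/

section

open Polynomial Set Filter Topology

section Ode

variable {α κ N : ℝ} {u v w : ℝ → ℝ}

/-- The equation eliminates `w`, leaving the derivative `-u² / 4 - (2α + 1) v²`. -/
theorem antitoneOn_energy (hα : 0 ≤ α) (hu : ∀ x, HasDerivAt u (v x) x)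
    (hv : ∀ x, HasDerivAt v (w x) x)
    (hode : ∀ x, x * w x + (α + 1) * v x + (κ - x / 4) * u x = 0) :
    Antitone (fun x => (κ - x / 4) * u x ^ 2 + x * v x ^ 2) := by
  have hd : ∀ x, HasDerivAt (fun x => (κ - x / 4) * u x ^ 2 + x * v x ^ 2)
      (-(u x ^ 2 / 4) - (2 * α + 1) * v x ^ 2) x := by
    intro x
    have h1 : HasDerivAt (fun x => κ - x / 4) (-(1 / 4)) x := by
      simpa using ((hasDerivAt_id x).div_const 4).const_sub κ
    refine ((h1.mul ((hu x).pow 2)).add ((hasDerivAt_id x).mul ((hv x).pow 2))).congr_deriv ?_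
    simp
    linear_combination 2 * v x * hode x
  refine antitone_of_deriv_nonpos (fun x => (hd x).differentiableAt) fun x => ?_
  rw [(hd x).deriv]
  nlinarith [sq_nonneg (u x), sq_nonneg (v x), mul_nonneg hα (sq_nonneg (v x))]

theorem hasDerivAt_integral_rpow_mul_sq (hα : 0 ≤ α) (hu : ∀ x, HasDerivAt u (v x) x) (x : ℝ) :
    HasDerivAt (fun x => ∫ s in (0 : ℝ)..x, s ^ α * u s ^ 2) (x ^ α * u x ^ 2) x := by
  have hc : Continuous u := continuous_iff_continuousAt.2 fun x => (hu x).continuousAt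
  have hc' : Continuous fun s : ℝ => s ^ α * u s ^ 2 :=
    (continuous_id.rpow_const fun _ => Or.inr hα).mul (hc.pow 2)
  exact intervalIntegral.integral_hasDerivAt_right (hc'.intervalIntegrable _ _)
    hc'.aestronglyMeasurable.stronglyMeasurableAtFilter hc'.continuousAt

/-- The weight `x ^ (2α + 1)` on the energy is the one for which the `v²` terms in the derivative
cancel. What remains is at most a constant times `x ^ α * u²`, so the energy is controlled by the
weighted `L²` norm of `u`. -/
theorem weighted_energy_le (hα : 0 ≤ α) (hκ : 0 < κ) (hu : ∀ x, HasDerivAt u (v x) x)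
    (hv : ∀ x, HasDerivAt v (w x) x)
    (hode : ∀ x, x * w x + (α + 1) * v x + (κ - x / 4) * u x = 0)
    {x : ℝ} (hx0 : 0 ≤ x) (hx : x ≤ 4 * κ) :
    x ^ (2 * α + 2) * v x ^ 2 + x ^ (2 * α + 1) * ((κ - x / 4) * u x ^ 2) ≤
      (2 * α + 1) * κ * (4 * κ) ^ α * ∫ s in (0 : ℝ)..x, s ^ α * u s ^ 2 := by
  have hcu : Continuous u := continuous_iff_continuousAt.2 fun x => (hu x).continuousAt
  have hcv : Continuous v := continuous_iff_continuousAt.2 fun x => (hv x).continuousAt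
  set K := (2 * α + 1) * κ * (4 * κ) ^ α
  set F : ℝ → ℝ := fun x => x ^ (2 * α + 2) * v x ^ 2 +
    x ^ (2 * α + 1) * ((κ - x / 4) * u x ^ 2) - K * ∫ s in (0 : ℝ)..x, s ^ α * u s ^ 2 with hF
  have hd : ∀ x, 0 < x → HasDerivAt F
      (x ^ (2 * α) * ((2 * α + 1) * (κ - x / 4) - x / 4) * u x ^ 2 - K * (x ^ α * u x ^ 2)) x := by
    intro x hx
    have h1 : HasDerivAt (fun x => κ - x / 4) (-(1 / 4)) x := by
      simpa using ((hasDerivAt_id x).div_const 4).const_sub κ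
    have h2 := Real.hasDerivAt_rpow_const (x := x) (p := 2 * α + 2) (Or.inl hx.ne')
    have h3 := Real.hasDerivAt_rpow_const (x := x) (p := 2 * α + 1) (Or.inl hx.ne')
    refine (((h2.mul ((hv x).pow 2)).add (h3.mul (h1.mul ((hu x).pow 2)))).sub
      ((hasDerivAt_integral_rpow_mul_sq hα hu x).const_mul K)).congr_deriv ?_
    have e1 : x ^ (2 * α + 1) = x * x ^ (2 * α) := by rw [Real.rpow_add_one hx.ne', mul_comm]
    have e2 : x ^ (2 * α + 2) = x ^ 2 * x ^ (2 * α) := by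
      rw [Real.rpow_add hx, Real.rpow_two, mul_comm]
    have e3 : 2 * α + 2 - 1 = 2 * α + 1 := by ring
    have e4 : 2 * α + 1 - 1 = 2 * α := by ring
    simp only [e3, e4, e1, e2, Pi.pow_apply, Pi.mul_apply, Nat.cast_ofNat]
    linear_combination 2 * x * x ^ (2 * α) * v x * hode x
  have hc : ContinuousOn F (Icc 0 (4 * κ)) := by
    refine Continuous.continuousOn ?_
    refine ((((continuous_id.rpow_const fun _ => Or.inr (by positivity)).mul (hcv.pow 2)).add
      ((continuous_id.rpow_const fun _ => Or.inr (by positivity)).mul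
      ((by fun_prop : Continuous fun x : ℝ => κ - x / 4).mul (hcu.pow 2)))).sub
      (continuous_const.mul ?_))
    exact continuous_iff_continuousAt.2 fun x =>
      (hasDerivAt_integral_rpow_mul_sq hα hu x).continuousAt
  have hanti : AntitoneOn F (Icc 0 (4 * κ)) := by
    refine antitoneOn_of_deriv_nonpos (convex_Icc _ _) hc ?_ ?_
    · intro x hx
      rw [interior_Icc] at hx
      exact (hd x hx.1).differentiableAt.differentiableWithinAt
    · intro x hx
      rw [interior_Icc] at hx
      rw [(hd x hx.1).deriv]
      have h1 : x ^ (2 * α) = x ^ α * x ^ α := by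
        rw [← Real.rpow_add hx.1]
        ring_nf
      have h2 : x ^ α ≤ (4 * κ) ^ α := Real.rpow_le_rpow hx.1.le hx.2.le hα
      have h0 : 0 < x ^ α := Real.rpow_pos_of_pos hx.1 _
      have h3 : (2 * α + 1) * (κ - x / 4) - x / 4 ≤ (2 * α + 1) * κ := by
        nlinarith [hx.1, mul_nonneg hα hx.1.le]
      have h4 : x ^ α * ((2 * α + 1) * (κ - x / 4) - x / 4) ≤ K := by
        calc _ ≤ x ^ α * ((2 * α + 1) * κ) := by gcongr
          _ ≤ (4 * κ) ^ α * ((2 * α + 1) * κ) := by gcongr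
          _ = K := by simp only [K]; ring
      have h5 : 0 ≤ x ^ α * u x ^ 2 := by positivity
      rw [h1]
      nlinarith [mul_le_mul_of_nonneg_right h4 h5]
  have := hanti (left_mem_Icc.2 (by positivity)) ⟨hx0, hx⟩ hx0
  have h0 : F 0 = 0 := by
    simp [hF, Real.zero_rpow (show 2 * α + 2 ≠ 0 by positivity),
      Real.zero_rpow (show 2 * α + 1 ≠ 0 by positivity)]
  rw [h0] at this
  simp only [hF] at this
  linarith

/-- Three zones. Up to `2κ` the coefficient `κ - x / 4` is at least `κ / 2`, so the decreasing
energy controls `u²`. From `2κ` to `4κ` that coefficient degenerates, and the weighted energy bounds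
`v` instead, whence the growth of `u²`. Beyond `4κ`, `u²` decreases. -/
theorem sq_le_of_ode (hα : 0 ≤ α) (hκ : 0 < κ) (hu : ∀ x, HasDerivAt u (v x) x)
    (hv : ∀ x, HasDerivAt v (w x) x)
    (hode : ∀ x, x * w x + (α + 1) * v x + (κ - x / 4) * u x = 0)
    (hint : ∀ x, 0 ≤ x → ∫ s in (0 : ℝ)..x, s ^ α * u s ^ 2 ≤ N)
    (hlim : Tendsto (fun x => x ^ (α + 1) * (u x * v x)) atTop (𝓝 0)) {x : ℝ} (hx : 0 ≤ x) :
    u x ^ 2 ≤ 2 * u 0 ^ 2 + (α + 3 / 2) * (N * κ ^ (-α)) := by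
  have hN : 0 ≤ N := by simpa using hint 0 le_rfl
  have hD : 0 ≤ N * κ ^ (-α) := by positivity
  have hleft : ∀ x, 0 ≤ x → x ≤ 2 * κ → u x ^ 2 ≤ 2 * u 0 ^ 2 := by
    intro x hx0 hx
    have h := antitoneOn_energy hα hu hv hode hx0
    simp only [zero_div, sub_zero, zero_mul, add_zero] at h
    have h1 : κ / 2 * u x ^ 2 ≤ (κ - x / 4) * u x ^ 2 := by
      gcongr
      linarith
    have h2 : 0 ≤ x * v x ^ 2 := by positivity
    have h3 : κ * u x ^ 2 ≤ κ * (2 * u 0 ^ 2) := by linarith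
    exact le_of_mul_le_mul_left h3 hκ
  have hmid : ∀ x, 2 * κ ≤ x → x ≤ 4 * κ →
      u x ^ 2 ≤ 2 * u 0 ^ 2 + (α + 3 / 2) * (N * κ ^ (-α)) := by
    intro x hx1 hx2
    -- `D` is the bound on `v²` left by the weighted energy after `x ^ (2α + 2)` is replaced by its
    -- least value `(2κ) ^ (2α + 2)`.
    set D := (2 * α + 1) / 4 * (N * κ ^ (-α)) / κ with hDdef
    have hv2 : ∀ y, 2 * κ ≤ y → y ≤ 4 * κ → v y ^ 2 ≤ D := by
      intro y hy1 hy2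
      have hy0 : 0 < y := by linarith
      have h := weighted_energy_le hα hκ hu hv hode hy0.le hy2
      have h1 : 0 ≤ y ^ (2 * α + 1) * ((κ - y / 4) * u y ^ 2) := by
        have : 0 ≤ κ - y / 4 := by linarith
        positivity
      have h2 : (2 * κ) ^ (2 * α + 2) * v y ^ 2 ≤ y ^ (2 * α + 2) * v y ^ 2 := by gcongr
      have h3 : (2 * α + 1) * κ * (4 * κ) ^ α * ∫ s in (0 : ℝ)..y, s ^ α * u s ^ 2 ≤
          (2 * α + 1) * κ * (4 * κ) ^ α * N := by
        gcongr
        exact hint y hy0.le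
      have h4 : (2 * α + 1) * κ * (4 * κ) ^ α * N = (2 * κ) ^ (2 * α + 2) * D := by
        have e1 : (2 * κ) ^ (2 * α + 2) = ((2 * κ) ^ α * (2 * κ) ^ α) * (2 * κ) ^ 2 := by
          rw [Real.rpow_add (by positivity), two_mul α, Real.rpow_add (by positivity),
            Real.rpow_two]
        have e2 : (4 * κ) ^ α = (2 * κ) ^ α * 2 ^ α := by
          rw [← Real.mul_rpow (by positivity) (by positivity)]
          ring_nf
        have e3 : (2 * κ) ^ α = 2 ^ α * κ ^ α := Real.mul_rpow (by positivity) hκ.le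
        have e4 : κ ^ α * κ ^ (-α) = 1 := by rw [← Real.rpow_add hκ]; simp
        have e5 : D * κ = (2 * α + 1) / 4 * (N * κ ^ (-α)) := by
          rw [hDdef]
          field_simp
        rw [e1, e2, e3]
        linear_combination -4 * κ * (2 ^ α * κ ^ α) ^ 2 * e5 -
          (2 * α + 1) * κ * (2 ^ α * κ ^ α) * N * 2 ^ α * e4
      have h5 : 0 < (2 * κ) ^ (2 * α + 2) := by positivity
      exact le_of_mul_le_mul_left (by linarith) h5
    set I : ℝ → ℝ := fun x => ∫ s in (0 : ℝ)..x, s ^ α * u s ^ 2 with hI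
    -- Since `2uv ≤ u² + v²`, the growth of `u²` is absorbed by the `L²` integral (where `x ^ α ≥
    -- (2κ) ^ α`) and by `D`.
    set F : ℝ → ℝ := fun x => u x ^ 2 - (2 * κ) ^ (-α) * I x - D * x with hF
    have hd : ∀ x, HasDerivAt F
        (2 * u x * v x - (2 * κ) ^ (-α) * (x ^ α * u x ^ 2) - D) x := by
      intro x
      refine ((((hu x).pow 2).sub ((hasDerivAt_integral_rpow_mul_sq hα hu x).const_mul _)).sub
        ((hasDerivAt_id x).const_mul D)).congr_deriv ?_
      simp
    have hanti : AntitoneOn F (Icc (2 * κ) (4 * κ)) := by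
      refine antitoneOn_of_deriv_nonpos (convex_Icc _ _)
        (fun x _ => (hd x).continuousAt.continuousWithinAt)
        (fun x _ => (hd x).differentiableAt.differentiableWithinAt) ?_
      intro y hy
      rw [interior_Icc] at hy
      rw [(hd y).deriv]
      have h1 : 1 ≤ (2 * κ) ^ (-α) * y ^ α := by
        rw [Real.rpow_neg (by positivity), ← div_eq_inv_mul, one_le_div (by positivity)]
        exact Real.rpow_le_rpow (by positivity) hy.1.le hα
      have h2 := hv2 y hy.1.le hy.2.le
      nlinarith [mul_le_mul_of_nonneg_right h1 (sq_nonneg (u y)), sq_nonneg (u y - v y)]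
    have h1 := hanti (left_mem_Icc.2 (by linarith)) ⟨hx1, hx2⟩ hx1
    have h2 := hleft (2 * κ) (by positivity) le_rfl
    have h3 : I x ≤ N := hint x (by linarith)
    have h4 : 0 ≤ I (2 * κ) := by
      refine intervalIntegral.integral_nonneg (by positivity) fun s hs => ?_
      have := Real.rpow_nonneg hs.1 α
      positivity
    have h5 : (2 * κ) ^ (-α) ≤ κ ^ (-α) :=
      Real.rpow_le_rpow_of_nonpos hκ (by linarith) (by linarith)
    have h6 : (2 * κ) ^ (-α) * I x ≤ N * κ ^ (-α) := by
      rw [mul_comm]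
      gcongr
    have h7 : 0 ≤ (2 * κ) ^ (-α) * I (2 * κ) := by positivity
    have h8 : D * x - D * (2 * κ) ≤ (α + 1 / 2) * (N * κ ^ (-α)) := by
      have e : D * (2 * κ) = (α + 1 / 2) * (N * κ ^ (-α)) := by
        rw [hDdef]
        field_simp
        ring
      have hD0 : 0 ≤ D := by positivity
      nlinarith
    simp only [hF] at h1
    linarith
  rcases le_total x (2 * κ) with h | h
  · exact (hleft x hx h).trans (le_add_of_nonneg_right (by positivity))
  rcases le_total x (4 * κ) with h' | h'
  · exact hmid x h h'
  refine le_trans ?_ (hmid (4 * κ) (by linarith) le_rfl)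
  -- Past `4κ` this function increases, and it tends to `0`; hence it is nonpositive, which is the
  -- sign of `(u²)' = 2uv`.
  set H : ℝ → ℝ := fun x => x ^ (α + 1) * (u x * v x) with hH
  have hd : ∀ x, 0 < x → HasDerivAt H (x ^ α * (-(κ - x / 4) * u x ^ 2 + x * v x ^ 2)) x := by
    intro x hx
    have h2 := Real.hasDerivAt_rpow_const (x := x) (p := α + 1) (Or.inl hx.ne')
    refine (h2.mul ((hu x).mul (hv x))).congr_deriv ?_
    have e1 : x ^ (α + 1) = x * x ^ α := by rw [Real.rpow_add_one hx.ne', mul_comm]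
    have e2 : α + 1 - 1 = α := by ring
    rw [e1, e2]
    simp only [Pi.mul_apply]
    linear_combination x ^ α * u x * hode x
  have hmono : MonotoneOn H (Ici (4 * κ)) := by
    refine monotoneOn_of_deriv_nonneg (convex_Ici _)
      (fun x hx => (hd x (by have : 4 * κ ≤ x := hx; linarith)).continuousAt.continuousWithinAt)
      (fun x hx => ?_) (fun x hx => ?_)
    all_goals
      rw [interior_Ici] at hx
      have hx' : 4 * κ < x := hx
      have hx0 : 0 < x := by linarith
    · exact (hd x hx0).differentiableAt.differentiableWithinAt
    · rw [(hd x hx0).deriv]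
      have : 0 ≤ -(κ - x / 4) := by linarith
      positivity
  have hneg : ∀ x, 4 * κ ≤ x → H x ≤ 0 := fun x hx =>
    ge_of_tendsto hlim ((eventually_ge_atTop x).mono fun y hy => hmono hx (hx.trans hy) hy)
  have hanti : AntitoneOn (fun x => u x ^ 2) (Ici (4 * κ)) := by
    refine antitoneOn_of_deriv_nonpos (convex_Ici _)
      (fun x _ => ((hu x).pow 2).continuousAt.continuousWithinAt)
      (fun x _ => ((hu x).pow 2).differentiableAt.differentiableWithinAt) ?_
    intro x hx
    rw [interior_Ici] at hx
    have hx' : 4 * κ < x := hx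
    have hx0 : 0 < x := by linarith
    have h1 := hneg x hx'.le
    have h2 : 0 < x ^ (α + 1) := by positivity
    have h3 : u x * v x ≤ 0 := by
      by_contra! h
      exact absurd h1 (not_le.2 (mul_pos h2 h))
    have h4 := ((hu x).pow 2).deriv
    change deriv (u ^ 2) x ≤ 0
    rw [h4]
    simp
    linarith
  exact hanti self_mem_Ici h' h'

end Ode

end

/-! ### Orthogonality and a bound on Laguerre functions uniform in the degree. -/

section

open Polynomial Set Filter Topology

theorem Gamma_add_natCast {x : ℝ} (hx : 0 < x) (k : ℕ) :
    Real.Gamma (x + k) = (ascPochhammer ℝ k).eval x * Real.Gamma x := by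
  induction k with
  | zero => simp
  | succ k ih =>
    rw [ascPochhammer_succ_eval, mul_right_comm, ← ih, mul_comm, ← Real.Gamma_add_one (by positivity)]
    push_cast
    ring_nf

theorem sum_alternating_choose_mul_eval (P : ℝ[X]) (m : ℕ) :
    ∑ j ∈ Finset.range (m + 1), (-1) ^ j * (m.choose j : ℝ) * P.eval (j : ℝ) =
      (-1) ^ m * (fwdDiff 1)^[m] P.eval 0 := by
  rw [fwdDiff_iter_eq_sum_shift, Finset.mul_sum]
  refine Finset.sum_congr rfl fun j hj => ?_
  obtain ⟨i, rfl⟩ := Nat.exists_eq_add_of_le (Finset.mem_range_succ_iff.1 hj)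
  have : (-1 : ℝ) ^ (j + i) * (-1) ^ i = (-1) ^ j := by
    rw [pow_add, mul_assoc, ← mul_pow]
    simp
  simp only [Nat.add_sub_cancel_left, zsmul_eq_mul, nsmul_eq_mul, mul_one, zero_add]
  push_cast
  rw [← this]
  ring

theorem integrableOn_rpow_mul_exp_mul_eval {s : ℝ} (hs : 0 ≤ s) (P : ℝ[X]) :
    IntegrableOn (fun x => x ^ s * (Real.exp (-x) * P.eval x)) (Ioi 0) := by
  induction P using Polynomial.induction_on' with
  | add p q hp hq =>
    refine (hp.add hq).congr_fun (fun x _ => ?_) measurableSet_Ioi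
    simp
    ring
  | monomial n c =>
    have h : IntegrableOn (fun x => Real.exp (-x) * x ^ (s + n + 1 - 1) * c) (Ioi 0) :=
      (Real.GammaIntegral_convergent (s := s + n + 1) (by positivity)).mul_const c
    refine h.congr_fun (fun x hx => ?_) measurableSet_Ioi
    have hx' : 0 < x := hx
    simp only [eval_monomial, add_sub_cancel_right, Real.rpow_add hx', Real.rpow_natCast]
    ring

theorem integral_rpow_mul_exp_mul_pow {s : ℝ} (hs : 0 ≤ s) (n : ℕ) :
    ∫ x in Ioi (0 : ℝ), x ^ s * (Real.exp (-x) * x ^ n) = Real.Gamma (n + s + 1) := by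
  rw [Real.Gamma_eq_integral (by positivity)]
  refine setIntegral_congr_fun measurableSet_Ioi fun x hx => ?_
  have hx' : 0 < x := hx
  have e : (n : ℝ) + s + 1 - 1 = s + n := by ring
  simp only [e, Real.rpow_add hx', Real.rpow_natCast]
  ring

theorem tendsto_rpow_mul_exp_mul_eval (s : ℝ) (P : ℝ[X]) :
    Tendsto (fun x => x ^ s * (Real.exp (-x) * P.eval x)) atTop (𝓝 0) := by
  induction P using Polynomial.induction_on' with
  | add p q hp hq =>
    refine ((hp.add hq).congr fun x => ?_).trans_eq (by simp)
    simp
    ring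
  | monomial n c =>
    have h := (tendsto_rpow_mul_exp_neg_mul_atTop_nhds_zero (s + n) 1 one_pos).mul_const c
    rw [zero_mul] at h
    refine h.congr' ?_
    filter_upwards [eventually_gt_atTop 0] with x hx
    simp only [eval_monomial, Real.rpow_add hx, Real.rpow_natCast, neg_mul, one_mul]
    ring

/-- Termwise integration gives Gamma quotients `Γ(j + k + α + 1) / Γ(j + α + 1)`, which are
polynomials of degree `k` in `j`. The alternating binomial sum is then an `m`-th finite difference:
it vanishes for `k < m` and is explicit for `k = m`. -/
theorem integral_laguerre_mul_pow {α : ℝ} (hα : 0 ≤ α) (m k : ℕ) :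
    ∫ x in Ioi (0 : ℝ), x ^ α * (Real.exp (-x) * (laguerre α m x * x ^ k)) =
      Real.Gamma (m + α + 1) / m.factorial * ((-1) ^ m *
        (fwdDiff 1)^[m] ((ascPochhammer ℝ k).comp (X + C (α + 1))).eval 0) := by
  rw [← sum_alternating_choose_mul_eval, Finset.mul_sum]
  have h1 : ∀ x : ℝ, x ^ α * (Real.exp (-x) * (laguerre α m x * x ^ k)) =
      ∑ j ∈ Finset.range (m + 1),
        laguerreCoeff α m j * (x ^ α * (Real.exp (-x) * x ^ (j + k))) := by
    intro x
    rw [laguerre, Finset.sum_mul, Finset.mul_sum, Finset.mul_sum]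
    refine Finset.sum_congr rfl fun j _ => ?_
    rw [laguerreCoeff, pow_add]
    ring
  simp_rw [h1]
  rw [integral_finsetSum]
  · refine Finset.sum_congr rfl fun j hj => ?_
    rw [integral_const_mul, integral_rpow_mul_exp_mul_pow hα]
    have hjm := Finset.mem_range_succ_iff.1 hj
    have e : (((j + k : ℕ) : ℝ)) + α + 1 = (j + α + 1) + k := by push_cast; ring
    rw [e, Gamma_add_natCast (by positivity), Nat.cast_choose ℝ hjm, laguerreCoeff]
    have := (Gamma_natCast_add_pos hα j).ne'
    simp only [eval_comp, eval_add, eval_X, eval_C, ← add_assoc]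
    field_simp
  · intro j _
    have := integrableOn_rpow_mul_exp_mul_eval hα (X ^ (j + k))
    simp only [eval_pow, eval_X] at this
    exact this.const_mul _

theorem monic_ascPochhammer_comp (a : ℝ) (k : ℕ) :
    ((ascPochhammer ℝ k).comp (X + C a)).Monic :=
  (monic_ascPochhammer ℝ k).comp_X_add_C a

theorem natDegree_ascPochhammer_comp (a : ℝ) (k : ℕ) :
    ((ascPochhammer ℝ k).comp (X + C a)).natDegree = k := by
  rw [natDegree_comp, natDegree_X_add_C, mul_one, ascPochhammer_natDegree]

theorem integral_laguerre_mul_pow_of_lt {α : ℝ} (hα : 0 ≤ α) {m k : ℕ} (hk : k < m) :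
    ∫ x in Ioi (0 : ℝ), x ^ α * (Real.exp (-x) * (laguerre α m x * x ^ k)) = 0 := by
  rw [integral_laguerre_mul_pow hα, Polynomial.fwdDiff_iter_eq_zero_of_degree_lt]
  · simp
  · rwa [natDegree_ascPochhammer_comp]

theorem integral_laguerre_mul_pow_self {α : ℝ} (hα : 0 ≤ α) (m : ℕ) :
    ∫ x in Ioi (0 : ℝ), x ^ α * (Real.exp (-x) * (laguerre α m x * x ^ m)) =
      (-1) ^ m * Real.Gamma (m + α + 1) := by
  have h := Polynomial.fwdDiff_iter_degree_eq_factorial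
    ((ascPochhammer ℝ m).comp (X + C (α + 1)))
  rw [natDegree_ascPochhammer_comp, (monic_ascPochhammer_comp _ _).leadingCoeff] at h
  rw [integral_laguerre_mul_pow hα, h]
  simp
  field_simp

/-- The factor of lower degree is expanded in monomials; only a monomial of degree `m` can pair
nontrivially with `L_m^α`. -/
theorem integral_laguerre_mul_laguerre {α : ℝ} (hα : 0 ≤ α) (m n : ℕ) :
    ∫ x in Ioi (0 : ℝ), x ^ α * (Real.exp (-x) * (laguerre α m x * laguerre α n x)) =
      if m = n then Real.Gamma (m + α + 1) / m.factorial else 0 := by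
  wlog hnm : n ≤ m generalizing m n
  · have h := this n m (le_of_not_ge hnm)
    simp_rw [mul_comm (laguerre α m _), h]
    rcases eq_or_ne m n with rfl | hne
    · simp
    · rw [if_neg hne, if_neg hne.symm]
  have h1 : ∀ x : ℝ, x ^ α * (Real.exp (-x) * (laguerre α m x * laguerre α n x)) =
      ∑ j ∈ Finset.range (n + 1),
        laguerreCoeff α n j * (x ^ α * (Real.exp (-x) * (laguerre α m x * x ^ j))) := by
    intro x
    conv_lhs => rw [laguerre.eq_1 α n, Finset.mul_sum, Finset.mul_sum, Finset.mul_sum]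
    refine Finset.sum_congr rfl fun j _ => ?_
    rw [laguerreCoeff]
    ring
  simp_rw [h1]
  rw [integral_finsetSum]
  · simp_rw [integral_const_mul]
    rcases hnm.eq_or_lt with rfl | hlt
    · rw [Finset.sum_eq_single n, if_pos rfl, integral_laguerre_mul_pow_self hα, laguerreCoeff]
      · have := (Gamma_natCast_add_pos hα n).ne'
        have h2 : (-1 : ℝ) ^ n * (-1) ^ n = 1 := by rw [← mul_pow]; simp
        simp only [Nat.sub_self, Nat.factorial_zero, Nat.cast_one, mul_one]
        field_simp
        linear_combination h2
      · intro j hj hne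
        rw [integral_laguerre_mul_pow_of_lt hα, mul_zero]
        exact lt_of_le_of_ne (Finset.mem_range_succ_iff.1 hj) hne
      · simp
    · rw [if_neg hlt.ne']
      refine Finset.sum_eq_zero fun j hj => ?_
      rw [integral_laguerre_mul_pow_of_lt hα, mul_zero]
      exact (Finset.mem_range_succ_iff.1 hj).trans_lt hlt
  · intro j _
    have := integrableOn_rpow_mul_exp_mul_eval hα (laguerrePoly α m * X ^ j)
    simp only [eval_mul, eval_laguerrePoly, eval_pow, eval_X] at this
    exact this.const_mul _

theorem integrableOn_laguerre_mul_laguerre {α : ℝ} (hα : 0 ≤ α) (m n : ℕ) :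
    IntegrableOn (fun x => x ^ α * (Real.exp (-x) * (laguerre α m x * laguerre α n x)))
      (Ioi 0) := by
  simpa only [eval_mul, eval_laguerrePoly] using
    integrableOn_rpow_mul_exp_mul_eval hα (laguerrePoly α m * laguerrePoly α n)

/-- The Laguerre functions are bounded, uniformly in the degree, by a multiple of their value
at the origin. -/
theorem exists_abs_exp_mul_laguerre_le {α : ℝ} (hα : 0 ≤ α) :
    ∃ M : ℝ, 0 < M ∧ ∀ (m : ℕ) (x : ℝ), 0 ≤ x →
      |Real.exp (-(x / 2)) * laguerre α m x| ≤ M * laguerre α m 0 := by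
  have hΓ : 0 < Real.Gamma (α + 1) := Real.Gamma_pos_of_pos (by positivity)
  set K := 2 + (α + 3 / 2) * (Real.Gamma (α + 1) * ((1 + α) * 2 ^ α)) with hK
  have hK0 : 0 < K := by positivity
  refine ⟨√K, by positivity, fun m x hx => ?_⟩
  set P := laguerrePoly α m with hP
  set κ : ℝ := m + (α + 1) / 2 with hκdef
  have hκ : 0 < κ := by positivity
  set V := derivative P - C (1 / 2) * P with hV
  set u : ℝ → ℝ := fun x => Real.exp (-(x / 2)) * P.eval x with hu
  set v : ℝ → ℝ := fun x => Real.exp (-(x / 2)) * V.eval x with hv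
  set w : ℝ → ℝ := fun x => Real.exp (-(x / 2)) * (derivative V - C (1 / 2) * V).eval x with hw
  have hder : ∀ (R : ℝ[X]) (x : ℝ), HasDerivAt (fun x => Real.exp (-(x / 2)) * R.eval x)
      (Real.exp (-(x / 2)) * (derivative R - C (1 / 2) * R).eval x) x := by
    intro R x
    have h1 : HasDerivAt (fun x : ℝ => -(x / 2)) (-(1 / 2)) x := by
      exact ((hasDerivAt_id x).div_const 2).neg
    refine (h1.exp.mul (R.hasDerivAt x)).congr_deriv ?_
    simp
    ring
  have hode : ∀ x, x * w x + (α + 1) * v x + (κ - x / 4) * u x = 0 := by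
    intro x
    have h := congrArg (Polynomial.eval x) (laguerrePoly_ode hα m)
    simp only [eval_add, eval_mul, eval_X, eval_sub, eval_C, eval_zero] at h
    simp only [hw, hv, hu, hV, eval_sub, eval_mul, eval_C, derivative_sub, derivative_mul,
      derivative_C, eval_add, eval_zero, hκdef]
    linear_combination Real.exp (-(x / 2)) * h
  have hexp : ∀ x : ℝ, Real.exp (-(x / 2)) * Real.exp (-(x / 2)) = Real.exp (-x) := by
    intro x
    rw [← Real.exp_add]
    ring_nf
  have hsq : ∀ s : ℝ, s ^ α * u s ^ 2 =
      s ^ α * (Real.exp (-s) * (laguerre α m s * laguerre α m s)) := by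
    intro s
    simp only [hu, hP, eval_laguerrePoly]
    rw [← hexp s]
    ring
  have hint : ∀ x, 0 ≤ x → ∫ s in (0 : ℝ)..x, s ^ α * u s ^ 2 ≤
      Real.Gamma (m + α + 1) / m.factorial := by
    intro x hx
    have h := integral_laguerre_mul_laguerre hα m m
    rw [if_pos rfl] at h
    rw [intervalIntegral.integral_of_le hx, ← h]
    simp_rw [hsq]
    refine setIntegral_mono_set (integrableOn_laguerre_mul_laguerre hα m m) ?_
      (Eventually.of_forall fun y hy => hy.1)
    filter_upwards [self_mem_ae_restrict measurableSet_Ioi] with y hy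
    have : 0 < y := hy
    have h2 := mul_self_nonneg (laguerre α m y)
    simp only [Pi.zero_apply]
    positivity
  have hlim : Tendsto (fun x => x ^ (α + 1) * (u x * v x)) atTop (𝓝 0) := by
    refine (tendsto_rpow_mul_exp_mul_eval (α + 1) (P * V)).congr fun x => ?_
    simp only [hu, hv, eval_mul]
    rw [← hexp x]
    ring
  have key := sq_le_of_ode hα hκ (hder P) (hder V) hode hint hlim hx
  have hu0 : u 0 = laguerre α m 0 := by simp [hu, hP, eval_laguerrePoly]
  have hL : Real.Gamma (m + α + 1) / m.factorial = Real.Gamma (α + 1) * laguerre α m 0 := by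
    rw [laguerre_zero]
    field_simp
  -- The squared `L²` norm is `Γ(α + 1) * L_m^α(0)`, so the factor `κ ^ (-α)` makes the second term
  -- of `key` bounded in `m`. It is then absorbed using `L_m^α(0) ≥ 1`.
  have h1 : laguerre α m 0 * κ ^ (-α) ≤ (1 + α) * 2 ^ α := by
    have h2 := mul_le_mul_of_nonneg_right (laguerre_zero_le hα m)
      (Real.rpow_nonneg hκ.le (-α))
    have h3 : κ ^ α * κ ^ (-α) = 1 := by rw [← Real.rpow_add hκ]; simp
    rwa [mul_assoc, h3, mul_one] at h2
  have h2 : u x ^ 2 ≤ K * laguerre α m 0 ^ 2 := by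
    have h3 := one_le_laguerre_zero hα m
    have h4 : (1 : ℝ) ≤ laguerre α m 0 ^ 2 := one_le_pow₀ h3
    have h5 : (α + 3 / 2) * (Real.Gamma (m + α + 1) / m.factorial * κ ^ (-α)) ≤
        (α + 3 / 2) * (Real.Gamma (α + 1) * ((1 + α) * 2 ^ α)) := by
      rw [hL, mul_assoc (Real.Gamma (α + 1))]
      gcongr
    have h6 : 0 ≤ (α + 3 / 2) * (Real.Gamma (α + 1) * ((1 + α) * 2 ^ α)) := by positivity
    change u x ^ 2 ≤ 2 * u 0 ^ 2 + _ at key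
    rw [hu0] at key
    nlinarith
  have h3 : Real.exp (-(x / 2)) * laguerre α m x = u x := by
    simp only [hu, hP, eval_laguerrePoly]
  rw [h3]
  refine abs_le_of_sq_le_sq ?_ (mul_nonneg (by positivity) (laguerre_zero_pos hα m).le)
  rw [mul_pow √K, Real.sq_sqrt hK0.le]
  exact h2

end

/-! ### Plancherel on the line and Bessel's inequality. -/

section

open Set Filter Topology FourierTransform SchwartzMap
open scoped ENNReal ContDiff

/-- The integral Fourier transform agrees with the `L²` Fourier transform on `L¹ ∩ L²`. -/
theorem fourier_toLp_ae_eq {f : ℝ → ℂ} (hf1 : Integrable f) (hf2 : MemLp f 2) :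
    (𝓕 (hf2.toLp f) : Lp ℂ 2 (volume : Measure ℝ)) =ᵐ[volume] 𝓕 f := by
  set F : Lp ℂ 2 (volume : Measure ℝ) := 𝓕 (hf2.toLp f) with hF
  have hFint : LocallyIntegrable F := (Lp.memLp F).locallyIntegrable (by norm_num)
  have hcont : Continuous (𝓕 f) :=
    VectorFourier.fourierIntegral_continuous Real.continuous_fourierChar
      (innerSL ℝ).continuous₂ hf1
  have hfint : LocallyIntegrable (𝓕 f) := hcont.locallyIntegrable
  -- Both transforms are tested against compactly supported smooth functions: in either case the
  -- Fourier transform moves onto the test function, where the two notions coincide.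
  have key : ∀ g : ℝ → ℝ, ContDiff ℝ ∞ g → HasCompactSupport g →
      ∫ x, g x • F x = ∫ x, g x • 𝓕 f x := by
    intro g hg hgc
    have hg₁ : HasCompactSupport (Complex.ofRealCLM ∘ g) := hgc.comp_left rfl
    have hg₂ : ContDiff ℝ ∞ (Complex.ofRealCLM ∘ g) := by fun_prop
    set G : 𝓢(ℝ, ℂ) := hg₁.toSchwartzMap hg₂ with hG
    have h1 : ∫ x, G x • F x = ∫ x, (𝓕 G) x • f x := by
      rw [← Lp.toTemperedDistribution_apply, hF, ← Lp.fourier_toTemperedDistribution_eq,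
        TemperedDistribution.fourier_apply, Lp.toTemperedDistribution_apply]
      refine integral_congr_ae ?_
      filter_upwards [hf2.coeFn_toLp] with x hx
      rw [hx]
    have h2 : ∫ x, (𝓕 (G : ℝ → ℂ)) x • f x = ∫ x, G x • 𝓕 f x := by
      have h := VectorFourier.integral_fourierIntegral_smul_eq_flip (L := innerₗ ℝ)
        (μ := volume) (ν := volume) Real.continuous_fourierChar continuous_inner G.integrable hf1
      rwa [flip_innerₗ] at h
    have h3 : ∀ x, G x = (g x : ℂ) := fun x => rfl
    rw [SchwartzMap.fourier_coe, h2] at h1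
    simpa only [h3, smul_eq_mul, Complex.real_smul] using h1
  exact ae_eq_of_integral_contDiff_smul_eq hFint hfint key

theorem lintegral_enorm_fourier_sq {f : ℝ → ℂ} (hf1 : Integrable f) (hf2 : MemLp f 2) :
    ∫⁻ w, ‖𝓕 f w‖ₑ ^ 2 = ∫⁻ t, ‖f t‖ₑ ^ 2 := by
  have h1 : eLpNorm (𝓕 f) 2 volume = eLpNorm f 2 volume := by
    rw [← eLpNorm_congr_ae (fourier_toLp_ae_eq hf1 hf2), ← eLpNorm_congr_ae hf2.coeFn_toLp,
      ← Lp.enorm_def, ← Lp.enorm_def, ← ofReal_norm, ← ofReal_norm, Lp.norm_fourier_eq]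
  have h2 : ∀ g : ℝ → ℂ, ∫⁻ w, ‖g w‖ₑ ^ 2 = eLpNorm g 2 volume ^ 2 := by
    intro g
    rw [eLpNorm_eq_lintegral_rpow_enorm_toReal two_ne_zero ENNReal.ofNat_ne_top,
      ← ENNReal.rpow_natCast (_ ^ _), ← ENNReal.rpow_mul]
    simp
  rw [h2, h2, h1]

theorem lintegral_comp_div {c : ℝ} (hc : 0 < c) {f : ℝ → ℝ≥0∞} (hf : Measurable f) :
    ∫⁻ x, f (x / c) = ENNReal.ofReal c * ∫⁻ x, f x := by
  have h := Real.map_volume_mul_left (a := c⁻¹) (inv_ne_zero hc.ne')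
  have h2 : ∫⁻ x, f (x / c) = ∫⁻ y, f y ∂(Measure.map (c⁻¹ * ·) volume) := by
    rw [lintegral_map hf (by fun_prop)]
    simp_rw [div_eq_inv_mul]
  rw [h2, h, lintegral_smul_measure, inv_inv, abs_of_pos hc, smul_eq_mul]

/-- For `f` in `L²` this is Plancherel after `l = 2πw`, the source of the factor `2π`; otherwise the
right side is infinite. -/
theorem lintegral_enorm_integral_exp_sq_le {f : ℝ → ℂ} (hf : Integrable f) :
    ∫⁻ l : ℝ, ‖∫ t : ℝ, f t * Complex.exp (Complex.I * (-l : ℝ) * t)‖ₑ ^ 2 ≤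
      ENNReal.ofReal (2 * Real.pi) * ∫⁻ t, ‖f t‖ₑ ^ 2 := by
  by_cases hf2 : MemLp f 2
  · have h1 : ∀ l : ℝ, ∫ t : ℝ, f t * Complex.exp (Complex.I * (-l : ℝ) * t) =
        𝓕 f (l / (2 * Real.pi)) := by
      intro l
      rw [Real.fourier_real_eq_integral_exp_smul]
      refine integral_congr_ae (Eventually.of_forall fun t => ?_)
      simp only [smul_eq_mul, mul_comm (f t)]
      congr 2
      have := Complex.ofReal_ne_zero.2 Real.pi_ne_zero
      push_cast
      field_simp
    have hcont : Continuous (𝓕 f) :=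
      VectorFourier.fourierIntegral_continuous Real.continuous_fourierChar
        (innerSL ℝ).continuous₂ hf
    simp_rw [h1]
    rw [lintegral_comp_div (c := 2 * Real.pi) (by positivity)
      (f := fun w => ‖𝓕 f w‖ₑ ^ 2) (by fun_prop), lintegral_enorm_fourier_sq hf hf2]
  · have h2 : ∫⁻ t, ‖f t‖ₑ ^ 2 = (⊤ : ℝ≥0∞) := by
      by_contra h
      refine hf2 ⟨hf.1, ?_⟩
      rw [eLpNorm_lt_top_iff_lintegral_rpow_enorm_lt_top two_ne_zero ENNReal.ofNat_ne_top]
      simpa using lt_top_iff_ne_top.2 h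
    rw [h2, ENNReal.mul_top (by simp [Real.pi_pos])]
    exact le_top

/-- Bessel's inequality for a sequence of real functions which is orthonormal in `L²(ν)`. -/
theorem tsum_enorm_integral_mul_sq_le {X : Type*} [MeasurableSpace X] {ν : Measure X}
    {e : ℕ → X → ℝ} (he : ∀ m, MemLp (e m) 2 ν)
    (horth : ∀ m n, ∫ x, e m x * e n x ∂ν = if m = n then 1 else 0)
    {F : X → ℂ} (hF : AEStronglyMeasurable F ν) :
    ∑' m, ‖∫ x, F x * (e m x : ℂ) ∂ν‖ₑ ^ 2 ≤ ∫⁻ x, ‖F x‖ₑ ^ 2 ∂ν := by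
  by_cases hF2 : MemLp F 2 ν
  · have heC : ∀ m, MemLp (fun x => (e m x : ℂ)) 2 ν := fun m => (he m).ofReal
    set E : ℕ → Lp ℂ 2 ν := fun m => (heC m).toLp _ with hE
    have hon : Orthonormal ℂ E := by
      rw [orthonormal_iff_ite]
      intro m n
      rw [L2.inner_def]
      have h : ∫ x, inner ℂ (E m x) (E n x) ∂ν = ∫ x, ((e m x * e n x : ℝ) : ℂ) ∂ν := by
        refine integral_congr_ae ?_
        filter_upwards [(heC m).coeFn_toLp, (heC n).coeFn_toLp] with x hm hn
        simp only [hE, hm, hn, RCLike.inner_apply, Complex.conj_ofReal]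
        push_cast
        ring
      rw [h, integral_complex_ofReal, horth]
      split_ifs <;> simp
    have hinner : ∀ m, inner ℂ (E m) (hF2.toLp F) = ∫ x, F x * (e m x : ℂ) ∂ν := by
      intro m
      rw [L2.inner_def]
      refine integral_congr_ae ?_
      filter_upwards [(heC m).coeFn_toLp, hF2.coeFn_toLp] with x hm hn
      simp only [hE, hm, hn, RCLike.inner_apply, Complex.conj_ofReal]
    have hnorm : ∫⁻ x, ‖F x‖ₑ ^ 2 ∂ν = ‖hF2.toLp F‖ₑ ^ 2 := by
      rw [Lp.enorm_def, eLpNorm_congr_ae hF2.coeFn_toLp,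
        eLpNorm_eq_lintegral_rpow_enorm_toReal two_ne_zero ENNReal.ofNat_ne_top,
        ← ENNReal.rpow_natCast (_ ^ _), ← ENNReal.rpow_mul]
      simp
    rw [hnorm]
    refine ENNReal.tsum_le_of_sum_range_le fun n => ?_
    have h := hon.sum_inner_products_le (hF2.toLp F) (s := Finset.range n)
    simp_rw [hinner] at h
    simp_rw [← ofReal_norm]
    rw [← ENNReal.ofReal_pow (norm_nonneg _)]
    simp_rw [← ENNReal.ofReal_pow (norm_nonneg _)]
    rw [← ENNReal.ofReal_sum_of_nonneg fun _ _ => by positivity]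
    exact ENNReal.ofReal_le_ofReal h
  · have h2 : ∫⁻ t, ‖F t‖ₑ ^ 2 ∂ν = (⊤ : ℝ≥0∞) := by
      by_contra h
      refine hF2 ⟨hF, ?_⟩
      rw [eLpNorm_lt_top_iff_lintegral_rpow_enorm_lt_top two_ne_zero ENNReal.ofNat_ne_top]
      simpa using lt_top_iff_ne_top.2 h
    rw [h2]
    exact le_top

end

/-! ### Boundedness of the characters and the `L²` estimate. -/

section

open Set Filter Topology
open scoped ENNReal

/-- The Gamma prefactor is exactly `1 / L_m^α(0)`, which cancels the growth allowed by
`exists_abs_exp_mul_laguerre_le`. -/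
theorem exists_norm_phi_le {α : ℝ} (hα : 0 ≤ α) :
    ∃ M : ℝ, 0 < M ∧ ∀ ξ z, ‖phi α ξ z‖ ≤ M := by
  obtain ⟨M, hM, h⟩ := exists_abs_exp_mul_laguerre_le hα
  refine ⟨M, hM, fun ξ z => ?_⟩
  have hL := laguerre_zero_pos hα ξ.2
  have hc : (ξ.2.factorial : ℝ) * Real.Gamma (α + 1) / Real.Gamma (ξ.2 + α + 1) =
      (laguerre α ξ.2 0)⁻¹ := by
    rw [laguerre_zero, inv_div, mul_comm]
  have he : ‖Complex.exp (Complex.I * ξ.1 * z.2)‖ = 1 := by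
    have e : Complex.I * ξ.1 * z.2 = ((ξ.1 * z.2 : ℝ) : ℂ) * Complex.I := by
      push_cast
      ring
    rw [e, Complex.norm_exp_ofReal_mul_I]
  rw [phi, norm_mul, norm_mul, he, mul_one, hc, Complex.norm_real, Complex.norm_real,
    Real.norm_eq_abs, Real.norm_eq_abs, abs_of_pos (inv_pos.2 hL), inv_mul_le_iff₀ hL, mul_comm _ M]
  exact h ξ.2 _ (by positivity)

/-- The radial part `x^(2α+1) dx / (π Γ(α+1))` of the measure `m_α`. -/
noncomputable def radialMeasure (α : ℝ) : Measure ℝ :=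
  ((volume : Measure ℝ).restrict (Ici 0)).withDensity
    (fun x => ENNReal.ofReal (x ^ (2 * α + 1) / (Real.pi * Real.Gamma (α + 1))))

theorem measurable_radialDensity (α : ℝ) : Measurable fun x : ℝ =>
    ENNReal.ofReal (x ^ (2 * α + 1) / (Real.pi * Real.Gamma (α + 1))) := by
  fun_prop

instance sFinite_radialMeasure (α : ℝ) : SFinite (radialMeasure α) := by
  unfold radialMeasure
  infer_instance

theorem haar_eq_prod (α : ℝ) : haar α = (radialMeasure α).prod volume := by
  rw [haar, radialMeasure, prod_withDensity_left (measurable_radialDensity α), carrier,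
    Measure.volume_eq_prod, ← Measure.prod_restrict, Measure.restrict_univ]

instance sFinite_haar (α : ℝ) : SFinite (haar α) := by
  rw [haar_eq_prod]
  infer_instance

theorem integral_radialMeasure {α : ℝ} (hα : 0 ≤ α) (f : ℝ → ℝ) :
    ∫ x, f x ∂radialMeasure α =
      ∫ x in Ioi (0 : ℝ), x ^ (2 * α + 1) / (Real.pi * Real.Gamma (α + 1)) * f x := by
  have hΓ : 0 < Real.Gamma (α + 1) := Real.Gamma_pos_of_pos (by positivity)
  rw [radialMeasure, integral_withDensity_eq_integral_toReal_smul (measurable_radialDensity α)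
    (Eventually.of_forall fun _ => ENNReal.ofReal_lt_top), integral_Ici_eq_integral_Ioi]
  refine setIntegral_congr_fun measurableSet_Ioi fun x hx => ?_
  have : 0 < x := hx
  simp only [smul_eq_mul]
  rw [ENNReal.toReal_ofReal (by positivity)]

theorem integral_rpow_mul_comp_sq {α r : ℝ} (hr : 0 < r) (h : ℝ → ℝ) :
    ∫ x in Ioi (0 : ℝ), x ^ (2 * α + 1) * h (r * x ^ 2) =
      1 / 2 * (r ^ (α + 1))⁻¹ * ∫ s in Ioi (0 : ℝ), s ^ α * h s := by
  have h1 := integral_comp_rpow_Ioi_of_pos (g := fun y : ℝ => y ^ α * h (r * y)) two_pos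
  have h2 := integral_comp_mul_left_Ioi (fun s : ℝ => s ^ α * h s) 0 hr
  have h3 : ∫ x in Ioi (0 : ℝ), x ^ (2 * α + 1) * h (r * x ^ 2) =
      ∫ x in Ioi (0 : ℝ), 1 / 2 *
        (((2 : ℝ) * x ^ ((2 : ℝ) - 1)) • ((x ^ (2 : ℝ)) ^ α * h (r * x ^ (2 : ℝ)))) := by
    refine setIntegral_congr_fun measurableSet_Ioi fun x hx => ?_
    have hx0 : 0 < x := hx
    have e : (2 : ℝ) - 1 = 1 := by norm_num
    simp only [e, Real.rpow_one, smul_eq_mul, ← Real.rpow_mul hx0.le]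
    rw [Real.rpow_add_one hx0.ne', Real.rpow_two]
    ring
  have h4 : ∫ y in Ioi (0 : ℝ), y ^ α * h (r * y) =
      (r ^ α)⁻¹ * ∫ y in Ioi (0 : ℝ), (r * y) ^ α * h (r * y) := by
    rw [← integral_const_mul]
    refine setIntegral_congr_fun measurableSet_Ioi fun y hy => ?_
    have hy0 : 0 < y := hy
    have : r ^ α ≠ 0 := (Real.rpow_pos_of_pos hr _).ne'
    simp only [Real.mul_rpow hr.le hy0.le]
    field_simp
  rw [h3, integral_const_mul, h1, h4, h2, mul_zero, Real.rpow_add_one hr.ne', smul_eq_mul, mul_inv]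
  ring

/-- The radial part of the Laguerre function, normalized in `L²`. -/
noncomputable def laguerreFun (α l : ℝ) (m : ℕ) (x : ℝ) : ℝ :=
  √(2 * Real.pi * |l| ^ (α + 1) / laguerre α m 0) *
    (Real.exp (-(|l| * x ^ 2 / 2)) * laguerre α m (|l| * x ^ 2))

theorem continuous_laguerreFun (α l : ℝ) (m : ℕ) : Continuous (laguerreFun α l m) := by
  unfold laguerreFun
  have := continuous_laguerre α m
  fun_prop

/-- Substituting `s = |l| x²` reduces this to Laguerre orthogonality. The unnormalized square
integral is `L_m^α(0) / (2π |l| ^ (α + 1))`, which explains the constant in `laguerreFun`. -/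
theorem integral_laguerreFun_mul {α : ℝ} (hα : 0 ≤ α) {l : ℝ} (hl : l ≠ 0) (m n : ℕ) :
    ∫ x, laguerreFun α l m x * laguerreFun α l n x ∂radialMeasure α = if m = n then 1 else 0 := by
  have hr : 0 < |l| := abs_pos.2 hl
  have hΓ : 0 < Real.Gamma (α + 1) := Real.Gamma_pos_of_pos (by positivity)
  set r := |l| with hrdef
  set c : ℕ → ℝ := fun m => √(2 * Real.pi * r ^ (α + 1) / laguerre α m 0) with hc
  have h1 : ∀ x : ℝ, x ^ (2 * α + 1) / (Real.pi * Real.Gamma (α + 1)) *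
      (laguerreFun α l m x * laguerreFun α l n x) =
      c m * c n / (Real.pi * Real.Gamma (α + 1)) * (x ^ (2 * α + 1) *
        (fun s => Real.exp (-s) * (laguerre α m s * laguerre α n s)) (r * x ^ 2)) := by
    intro x
    have e : Real.exp (-(r * x ^ 2)) =
        Real.exp (-(r * x ^ 2 / 2)) * Real.exp (-(r * x ^ 2 / 2)) := by
      rw [← Real.exp_add]
      ring_nf
    simp only [laguerreFun, ← hrdef, e, hc]
    ring
  rw [integral_radialMeasure hα]
  simp_rw [h1]
  rw [integral_const_mul, integral_rpow_mul_comp_sq hr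
    (fun s => Real.exp (-s) * (laguerre α m s * laguerre α n s)), integral_laguerre_mul_laguerre hα]
  split_ifs with h
  · subst h
    have hL := laguerre_zero_pos hα m
    have e1 : c m * c m = 2 * Real.pi * r ^ (α + 1) / laguerre α m 0 :=
      Real.mul_self_sqrt (by positivity)
    have e2 : Real.Gamma (m + α + 1) / m.factorial = Real.Gamma (α + 1) * laguerre α m 0 := by
      rw [laguerre_zero]
      field_simp
    have e3 : 0 < r ^ (α + 1) := by positivity
    have := Real.pi_pos
    rw [e1, e2]
    field_simp
  · simp

theorem memLp_laguerreFun {α : ℝ} (hα : 0 ≤ α) {l : ℝ} (hl : l ≠ 0) (m : ℕ) :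
    MemLp (laguerreFun α l m) 2 (radialMeasure α) := by
  rw [memLp_two_iff_integrable_sq (continuous_laguerreFun α l m).aestronglyMeasurable]
  -- A nonintegrable function has Bochner integral `0`, whereas this integral is `1`.
  refine Integrable.of_integral_ne_zero ?_
  simp_rw [sq]
  rw [integral_laguerreFun_mul hα hl]
  simp

theorem measurable_laguerre_uncurry (α : ℝ) :
    Measurable fun q : ℕ × ℝ => laguerre α q.1 q.2 :=
  measurable_from_prod_countable_right fun m => (continuous_laguerre α m).measurable

theorem measurable_phi_neg (α : ℝ) :
    Measurable fun p : (ℝ × ℕ) × (ℝ × ℝ) => phi α (-p.1.1, p.1.2) p.2 := by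
  have hm : Measurable fun p : (ℝ × ℕ) × (ℝ × ℝ) => p.1.2 := by fun_prop
  have h0 : Measurable fun p : (ℝ × ℕ) × (ℝ × ℝ) => |-p.1.1| * p.2.1 ^ 2 := by fun_prop
  have h1 := (measurable_laguerre_uncurry α).comp (hm.prodMk h0)
  have h2 : Measurable fun m : ℕ =>
      (m.factorial : ℝ) * Real.Gamma (α + 1) / Real.Gamma (m + α + 1) := measurable_from_nat
  have h3 := h2.comp hm
  have h4 : Measurable fun p : (ℝ × ℕ) × (ℝ × ℝ) =>
      Complex.exp (Complex.I * (-p.1.1 : ℝ) * p.2.2) := by fun_prop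
  have h5 : Measurable fun p : (ℝ × ℕ) × (ℝ × ℝ) =>
      Real.exp (-(|-p.1.1| * p.2.1 ^ 2 / 2)) := by fun_prop
  exact (h3.complex_ofReal.fun_mul h4).fun_mul (h5.fun_mul h1).complex_ofReal

theorem stronglyMeasurable_transform (α : ℝ) {g : ℝ × ℝ → ℂ} (hg : Measurable g) :
    StronglyMeasurable (transform α g) := by
  have h : Measurable fun p : (ℝ × ℕ) × (ℝ × ℝ) => g p.2 * phi α (-p.1.1, p.1.2) p.2 :=
    (hg.comp measurable_snd).mul (measurable_phi_neg α)
  exact h.stronglyMeasurable.integral_prod_right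

theorem integrable_mul_phi {α : ℝ} (hα : 0 ≤ α) {g : ℝ × ℝ → ℂ} (hg : Integrable g (haar α))
    (ξ : ℝ × ℕ) : Integrable (fun z => g z * phi α (-ξ.1, ξ.2) z) (haar α) := by
  obtain ⟨M, _, h⟩ := exists_norm_phi_le hα
  refine hg.mul_bdd (c := M) ?_ (Eventually.of_forall fun z => h _ z)
  exact ((measurable_phi_neg α).comp (measurable_prodMk_left (x := ξ))).aestronglyMeasurable

theorem transform_eq_integral {α : ℝ} (hα : 0 ≤ α) {g : ℝ × ℝ → ℂ} (hg : Integrable g (haar α))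
    (l : ℝ) (m : ℕ) :
    transform α g (l, m) = ∫ x, (∫ t : ℝ, g (x, t) * Complex.exp (Complex.I * (-l : ℝ) * t)) *
      (((laguerre α m 0)⁻¹ * (Real.exp (-(|l| * x ^ 2 / 2)) * laguerre α m (|l| * x ^ 2)) : ℝ) : ℂ)
        ∂radialMeasure α := by
  have h := integrable_mul_phi hα hg (l, m)
  rw [haar_eq_prod] at h
  rw [transform, haar_eq_prod, integral_prod _ h]
  refine integral_congr_ae (Eventually.of_forall fun x => ?_)
  simp only
  rw [← integral_mul_const]
  refine integral_congr_ae (Eventually.of_forall fun t => ?_)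
  have hc : (m.factorial : ℝ) * Real.Gamma (α + 1) / Real.Gamma (m + α + 1) =
      (laguerre α m 0)⁻¹ := by
    rw [laguerre_zero, inv_div, mul_comm]
  simp only [phi, abs_neg, hc]
  push_cast
  ring

theorem lintegral_plancherel (α : ℝ) {G : ℝ × ℕ → ℝ≥0∞} (hG : Measurable G) :
    ∫⁻ ξ, G ξ ∂plancherel α =
      ∫⁻ l : ℝ, ∑' m : ℕ, ENNReal.ofReal (laguerre α m 0 * |l| ^ (α + 1)) * G (l, m) := by
  have hw : Measurable fun ξ : ℝ × ℕ =>
      ENNReal.ofReal (laguerre α ξ.2 0 * |ξ.1| ^ (α + 1)) := by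
    have h : Measurable fun ξ : ℝ × ℕ => laguerre α ξ.2 0 :=
      (measurable_from_nat (f := fun m : ℕ => laguerre α m 0)).comp measurable_snd
    fun_prop
  rw [plancherel, lintegral_withDensity_eq_lintegral_mul _ hw hG, lintegral_prod]
  · simp [lintegral_count]
  · exact (hw.mul hG).aemeasurable

/-- The Plancherel density is what turns the squared transform into a squared coefficient against
`laguerreFun`. The factor `2π` later cancels the one from the Fourier transform in `t`. -/
theorem ofReal_mul_enorm_transform_sq {α : ℝ} (hα : 0 ≤ α) {g : ℝ × ℝ → ℂ}
    (hg : Integrable g (haar α)) (l : ℝ) (m : ℕ) :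
    ENNReal.ofReal (2 * Real.pi) *
      (ENNReal.ofReal (laguerre α m 0 * |l| ^ (α + 1)) * ‖transform α g (l, m)‖ₑ ^ 2) =
      ‖∫ x, (∫ t : ℝ, g (x, t) * Complex.exp (Complex.I * (-l : ℝ) * t)) *
        (laguerreFun α l m x : ℂ) ∂radialMeasure α‖ₑ ^ 2 := by
  have hL := laguerre_zero_pos hα m
  set c := √(2 * Real.pi * |l| ^ (α + 1) / laguerre α m 0) * laguerre α m 0 with hc
  have h1 : ∫ x, (∫ t : ℝ, g (x, t) * Complex.exp (Complex.I * (-l : ℝ) * t)) *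
        (laguerreFun α l m x : ℂ) ∂radialMeasure α = c * transform α g (l, m) := by
    rw [transform_eq_integral hα hg, ← integral_const_mul]
    refine integral_congr_ae (Eventually.of_forall fun x => ?_)
    simp only [laguerreFun, hc]
    have : (laguerre α m 0 : ℂ) ≠ 0 := Complex.ofReal_ne_zero.2 hL.ne'
    push_cast
    field_simp
  have h2 : ‖(c : ℂ)‖ₑ ^ 2 = ENNReal.ofReal (2 * Real.pi) *
      ENNReal.ofReal (laguerre α m 0 * |l| ^ (α + 1)) := by
    rw [← ofReal_norm, Complex.norm_real, ← ENNReal.ofReal_pow (norm_nonneg _),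
      ← ENNReal.ofReal_mul (by positivity), Real.norm_eq_abs, sq_abs, hc, mul_pow,
      Real.sq_sqrt (by positivity)]
    congr 1
    field_simp
  rw [h1, enorm_mul, mul_pow, h2, mul_assoc]

/-- The `L²` bound for the Fourier–Laguerre transform. -/
theorem lintegral_enorm_transform_sq_le {α : ℝ} (hα : 0 ≤ α) {g : ℝ × ℝ → ℂ}
    (hgm : Measurable g) (hg : Integrable g (haar α)) :
    ∫⁻ ξ, ‖transform α g ξ‖ₑ ^ 2 ∂plancherel α ≤ ∫⁻ z, ‖g z‖ₑ ^ 2 ∂haar α := by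
  set F : ℝ → ℝ → ℂ := fun l x =>
    ∫ t : ℝ, g (x, t) * Complex.exp (Complex.I * (-l : ℝ) * t) with hF
  have hFm : StronglyMeasurable fun p : ℝ × ℝ => F p.1 p.2 := by
    have : Measurable fun p : (ℝ × ℝ) × ℝ =>
        g (p.1.2, p.2) * Complex.exp (Complex.I * (-p.1.1 : ℝ) * p.2) := by fun_prop
    exact this.stronglyMeasurable.integral_prod_right
  have hpi : ENNReal.ofReal (2 * Real.pi) ≠ 0 := by
    simp [Real.pi_pos]
  refine (ENNReal.mul_le_mul_iff_right hpi ENNReal.ofReal_ne_top).1 ?_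
  rw [lintegral_plancherel α
    ((stronglyMeasurable_transform α hgm).measurable.enorm.pow_const 2),
    ← lintegral_const_mul' _ _ ENNReal.ofReal_ne_top]
  simp_rw [← ENNReal.tsum_mul_left, ofReal_mul_enorm_transform_sq hα hg]
  -- Bessel in `x` for each `l ≠ 0`, then Tonelli, then Plancherel in `t` for almost every `x`.
  calc ∫⁻ l : ℝ, ∑' m : ℕ, ‖∫ x, F l x * (laguerreFun α l m x : ℂ) ∂radialMeasure α‖ₑ ^ 2
      ≤ ∫⁻ l : ℝ, ∫⁻ x, ‖F l x‖ₑ ^ 2 ∂radialMeasure α := by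
        refine lintegral_mono_ae ?_
        have h0 : ∀ᵐ l : ℝ, l ≠ 0 := by
          simp [ae_iff]
        filter_upwards [h0] with l hl
        exact tsum_enorm_integral_mul_sq_le (memLp_laguerreFun hα hl)
          (integral_laguerreFun_mul hα hl)
          (hFm.comp_measurable measurable_prodMk_left).aestronglyMeasurable
    _ = ∫⁻ x, (∫⁻ l : ℝ, ‖F l x‖ₑ ^ 2) ∂radialMeasure α :=
        lintegral_lintegral_swap (hFm.measurable.enorm.pow_const 2).aemeasurable
    _ ≤ ∫⁻ x, (ENNReal.ofReal (2 * Real.pi) * ∫⁻ t, ‖g (x, t)‖ₑ ^ 2) ∂radialMeasure α := by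
        refine lintegral_mono_ae ?_
        rw [haar_eq_prod] at hg
        filter_upwards [hg.prod_right_ae] with x hx
        exact lintegral_enorm_integral_exp_sq_le hx
    _ = ENNReal.ofReal (2 * Real.pi) * ∫⁻ z, ‖g z‖ₑ ^ 2 ∂haar α := by
        rw [lintegral_const_mul' _ _ ENNReal.ofReal_ne_top, haar_eq_prod, lintegral_prod]
        exact (hgm.enorm.pow_const 2).aemeasurable

end

/-! ### Hausdorff–Young by real interpolation. -/

section

open Set Filter Topology
open scoped ENNReal

theorem lintegral_Ioc_ofReal_rpow {q c : ℝ} (hq : -1 < q) (hc : 0 ≤ c) :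
    ∫⁻ t in Ioc 0 c, ENNReal.ofReal (t ^ q) = ENNReal.ofReal (c ^ (q + 1) / (q + 1)) := by
  rw [← ofReal_integral_eq_lintegral_ofReal, ← intervalIntegral.integral_of_le hc,
    integral_rpow (Or.inl hq), Real.zero_rpow (by linarith), sub_zero]
  · rw [← IntegrableOn, ← intervalIntegrable_iff_integrableOn_Ioc_of_le hc]
    exact intervalIntegral.intervalIntegrable_rpow' hq
  · filter_upwards [self_mem_ae_restrict measurableSet_Ioc] with t ht
    exact Real.rpow_nonneg ht.1.le _

theorem transform_add {α : ℝ} (hα : 0 ≤ α) {f g : ℝ × ℝ → ℂ} (hf : Integrable f (haar α))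
    (hg : Integrable g (haar α)) (ξ : ℝ × ℕ) :
    transform α (f + g) ξ = transform α f ξ + transform α g ξ := by
  simp only [transform, Pi.add_apply, add_mul]
  exact integral_add (integrable_mul_phi hα hf ξ) (integrable_mul_phi hα hg ξ)

theorem enorm_transform_le {α M : ℝ} (hM : ∀ ξ z, ‖phi α ξ z‖ ≤ M) (f : ℝ × ℝ → ℂ) (ξ : ℝ × ℕ) :
    ‖transform α f ξ‖ₑ ≤ ENNReal.ofReal M * ∫⁻ z, ‖f z‖ₑ ∂haar α := by
  rw [mul_comm, ← lintegral_mul_const' _ _ ENNReal.ofReal_ne_top]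
  refine (enorm_integral_le_lintegral_enorm _).trans (lintegral_mono fun z => ?_)
  rw [enorm_mul, ← ofReal_norm (phi α _ z)]
  gcongr
  exact hM _ z

theorem transform_congr_ae {α : ℝ} {f g : ℝ × ℝ → ℂ} (h : f =ᵐ[haar α] g) :
    transform α f = transform α g := by
  funext ξ
  refine integral_congr_ae ?_
  filter_upwards [h] with z hz
  rw [hz]

theorem transform_zero (α : ℝ) : transform α 0 = 0 := by
  funext ξ
  simp [transform]

/-- The distribution function of the transform, estimated by splitting `g` at height `h`. -/
theorem plancherel_lt_norm_transform_le {α : ℝ} (hα : 0 ≤ α) {M : ℝ}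
    (hM : ∀ ξ z, ‖phi α ξ z‖ ≤ M) {g : ℝ × ℝ → ℂ} (hgm : Measurable g)
    (hg : Integrable g (haar α)) {h s : ℝ} (hs : 0 < s)
    (hlarge : ENNReal.ofReal M * ∫⁻ z in {z | h < ‖g z‖}, ‖g z‖ₑ ∂haar α ≤ ENNReal.ofReal (s / 2)) :
    plancherel α {ξ | s < ‖transform α g ξ‖} ≤
      ENNReal.ofReal (4 / s ^ 2) * ∫⁻ z in {z | ‖g z‖ ≤ h}, ‖g z‖ₑ ^ 2 ∂haar α := by
  set A : Set (ℝ × ℝ) := {z | h < ‖g z‖} with hA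
  have hAm : MeasurableSet A := measurableSet_lt measurable_const hgm.norm
  have hAc : Aᶜ = {z | ‖g z‖ ≤ h} := by
    ext z
    simp [hA]
  set g₁ := A.indicator g with hg1
  set g₂ := Aᶜ.indicator g with hg2
  have hsum : g₁ + g₂ = g := indicator_self_add_compl A g
  have hg₁ : Integrable g₁ (haar α) := hg.indicator hAm
  have hg₂ : Integrable g₂ (haar α) := hg.indicator hAm.compl
  have hg₂m : Measurable g₂ := hgm.indicator hAm.compl
  -- The part of `g` above height `h` contributes at most `s / 2`, so the part below must contribute
  -- at least `s / 2`; Chebyshev and the `L²` bound then apply to it.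
  have hsub : {ξ | s < ‖transform α g ξ‖} ⊆
      {ξ | ENNReal.ofReal ((s / 2) ^ 2) ≤ ‖transform α g₂ ξ‖ₑ ^ 2} := by
    intro ξ hξ
    have h1 : ‖transform α g₁ ξ‖ ≤ s / 2 := by
      have h2 := enorm_transform_le hM g₁ ξ
      have h3 : ∫⁻ z, ‖g₁ z‖ₑ ∂haar α = ∫⁻ z in A, ‖g z‖ₑ ∂haar α := by
        rw [← lintegral_indicator hAm]
        simp [hg1, enorm_indicator_eq_indicator_enorm]
      rw [h3] at h2
      have h4 := h2.trans hlarge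
      rw [← ofReal_norm] at h4
      exact (ENNReal.ofReal_le_ofReal_iff (by positivity)).1 h4
    have h5 : s < ‖transform α g ξ‖ := hξ
    rw [← hsum, transform_add hα hg₁ hg₂] at h5
    have h6 := norm_add_le (transform α g₁ ξ) (transform α g₂ ξ)
    have h7 : s / 2 ≤ ‖transform α g₂ ξ‖ := by linarith
    simp only [mem_ofPred_eq]
    rw [← ofReal_norm, ← ENNReal.ofReal_pow (norm_nonneg _)]
    gcongr
  have h8 := mul_meas_ge_le_lintegral (μ := plancherel α)
    ((stronglyMeasurable_transform α hg₂m).measurable.enorm.pow_const 2)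
    (ENNReal.ofReal ((s / 2) ^ 2))
  have h9 := h8.trans (lintegral_enorm_transform_sq_le hα hg₂m hg₂)
  have h10 : ∫⁻ z, ‖g₂ z‖ₑ ^ 2 ∂haar α = ∫⁻ z in {z | ‖g z‖ ≤ h}, ‖g z‖ₑ ^ 2 ∂haar α := by
    rw [← hAc, ← lintegral_indicator hAm.compl]
    refine lintegral_congr fun z => ?_
    by_cases hz : z ∈ Aᶜ <;> simp [hg2, indicator, hz]
  rw [h10] at h9
  calc plancherel α {ξ | s < ‖transform α g ξ‖}
      ≤ plancherel α {ξ | ENNReal.ofReal ((s / 2) ^ 2) ≤ ‖transform α g₂ ξ‖ₑ ^ 2} :=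
        measure_mono hsub
    _ = ENNReal.ofReal (4 / s ^ 2) * (ENNReal.ofReal ((s / 2) ^ 2) *
        plancherel α {ξ | ENNReal.ofReal ((s / 2) ^ 2) ≤ ‖transform α g₂ ξ‖ₑ ^ 2}) := by
        rw [← mul_assoc, ← ENNReal.ofReal_mul (by positivity)]
        have : 4 / s ^ 2 * (s / 2) ^ 2 = 1 := by
          field_simp
          norm_num
        rw [this]
        simp
    _ ≤ _ := by gcongr

/-- Marcinkiewicz's argument: the layer-cake formula with a cut of `g` at a height depending on the
level `s`. Letting the height depend also on `S` gives the correct homogeneity `S ^ (p - 1)`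
directly. Convergence of `∫ s ^ (p - 3)` at `0` is where `p > 2` enters. -/
theorem lintegral_enorm_transform_rpow_le {α : ℝ} (hα : 0 ≤ α) {M : ℝ} (hM0 : 0 < M)
    (hM : ∀ ξ z, ‖phi α ξ z‖ ≤ M) {p : ℝ} (hp : 2 < p) {g : ℝ × ℝ → ℂ} (hgm : Measurable g)
    (hg : Integrable g (haar α)) {S : ℝ} (hS : 0 < S)
    (hgS : ∫⁻ z, ‖g z‖ₑ ^ (p / (p - 1)) ∂haar α = ENNReal.ofReal S) :
    ∫⁻ ξ, ‖transform α g ξ‖ₑ ^ p ∂plancherel α ≤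
      ENNReal.ofReal (p * (4 * (2 * M) ^ (p - 2) / (p - 2)) * S ^ (p - 1)) := by
  have hp1 : 0 < p - 1 := by linarith
  have hp2 : 0 < p - 2 := by linarith
  -- Above height `h`, `|g| ≤ h ^ (-1/(p-1)) * |g| ^ (p/(p-1))`, whose integral is at most `s /
  -- (2M)` for this choice.
  set h : ℝ → ℝ := fun s => (2 * M * S / s) ^ (p - 1) with hh
  have hlarge : ∀ s, 0 < s → ENNReal.ofReal M * ∫⁻ z in {z | h s < ‖g z‖}, ‖g z‖ₑ ∂haar α ≤
      ENNReal.ofReal (s / 2) := by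
    intro s hs
    have hhs : 0 < h s := by positivity
    have h1 : ∫⁻ z in {z | h s < ‖g z‖}, ‖g z‖ₑ ∂haar α ≤
        ∫⁻ z, ENNReal.ofReal (s / (2 * M * S)) * ‖g z‖ₑ ^ (p / (p - 1)) ∂haar α := by
      rw [← lintegral_indicator (measurableSet_lt measurable_const hgm.norm)]
      refine lintegral_mono fun z => ?_
      by_cases hz : h s < ‖g z‖
      · have hz0 : 0 < ‖g z‖ := hhs.trans hz
        rw [indicator_of_mem (by exact hz), ← ofReal_norm,
          ENNReal.ofReal_rpow_of_pos hz0, ← ENNReal.ofReal_mul (by positivity)]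
        refine ENNReal.ofReal_le_ofReal ?_
        have h2 : p / (p - 1) = 1 + 1 / (p - 1) := by
          field_simp
          ring
        have h3 : 2 * M * S / s ≤ ‖g z‖ ^ (1 / (p - 1)) := by
          have h4 := Real.rpow_le_rpow hhs.le hz.le (by positivity : 0 ≤ 1 / (p - 1))
          rwa [hh, ← Real.rpow_mul (by positivity), mul_one_div_cancel hp1.ne',
            Real.rpow_one] at h4
        rw [h2, Real.rpow_add hz0, Real.rpow_one]
        calc ‖g z‖ = s / (2 * M * S) * (‖g z‖ * (2 * M * S / s)) := by field_simp
          _ ≤ _ := by gcongr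
      · rw [indicator_of_notMem (by exact hz)]
        exact zero_le
    rw [lintegral_const_mul' _ _ ENNReal.ofReal_ne_top, hgS] at h1
    calc _ ≤ ENNReal.ofReal M * (ENNReal.ofReal (s / (2 * M * S)) * ENNReal.ofReal S) := by gcongr
      _ = ENNReal.ofReal (s / 2) := by
        rw [← ENNReal.ofReal_mul (by positivity), ← ENNReal.ofReal_mul (by positivity)]
        congr 1
        field_simp
  have hlayer := lintegral_rpow_eq_lintegral_meas_lt_mul (plancherel α)
    (f := fun ξ => ‖transform α g ξ‖) (Eventually.of_forall fun _ => norm_nonneg _)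
    (stronglyMeasurable_transform α hgm).norm.measurable.aemeasurable (p := p) (by linarith)
  have e1 : ∫⁻ ξ, ‖transform α g ξ‖ₑ ^ p ∂plancherel α =
      ∫⁻ ξ, ENNReal.ofReal (‖transform α g ξ‖ ^ p) ∂plancherel α := by
    refine lintegral_congr fun ξ => ?_
    rw [← ofReal_norm, ENNReal.ofReal_rpow_of_nonneg (norm_nonneg _) (by linarith)]
  set Φ : ℝ → ℝ × ℝ → ℝ≥0∞ := fun s z =>
    {q : ℝ × ℝ × ℝ | ‖g q.2‖ ≤ h q.1}.indicator
      (fun q => ENNReal.ofReal (4 * q.1 ^ (p - 3)) * ‖g q.2‖ₑ ^ 2) (s, z) with hΦ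
  have hhm : Measurable h := by fun_prop
  have hΦm : Measurable (Function.uncurry Φ) := by
    have h1 : MeasurableSet {q : ℝ × ℝ × ℝ | ‖g q.2‖ ≤ h q.1} :=
      measurableSet_le (by fun_prop) (by fun_prop)
    exact Measurable.indicator (by fun_prop) h1
  have hpt : ∀ s, 0 < s → plancherel α {ξ | s < ‖transform α g ξ‖} * ENNReal.ofReal (s ^ (p - 1)) ≤
      ∫⁻ z, Φ s z ∂haar α := by
    intro s hs
    have h1 := plancherel_lt_norm_transform_le hα hM hgm hg hs (hlarge s hs)
    have h2 : ∫⁻ z, Φ s z ∂haar α = ENNReal.ofReal (4 * s ^ (p - 3)) *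
        ∫⁻ z in {z | ‖g z‖ ≤ h s}, ‖g z‖ₑ ^ 2 ∂haar α := by
      rw [← lintegral_const_mul' _ _ ENNReal.ofReal_ne_top,
        ← lintegral_indicator (measurableSet_le hgm.norm measurable_const)]
      rfl
    rw [h2]
    calc _ ≤ (ENNReal.ofReal (4 / s ^ 2) * ∫⁻ z in {z | ‖g z‖ ≤ h s}, ‖g z‖ₑ ^ 2 ∂haar α) *
          ENNReal.ofReal (s ^ (p - 1)) := by gcongr
      _ = _ := by
        rw [mul_right_comm, ← ENNReal.ofReal_mul (by positivity)]
        congr 2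
        have h3 : s ^ (p - 1) = s ^ (p - 3) * s ^ 2 := by
          rw [← Real.rpow_two, ← Real.rpow_add hs]
          ring_nf
        rw [h3]
        field_simp
  have hinner : ∀ z, ∫⁻ s in Ioi (0 : ℝ), Φ s z ≤
      ENNReal.ofReal (4 * (2 * M * S) ^ (p - 2) / (p - 2)) * ‖g z‖ₑ ^ (p / (p - 1)) := by
    intro z
    rcases eq_or_ne (g z) 0 with hz | hz
    · have : ∀ s, Φ s z = 0 := fun s => by simp [hΦ, indicator, hz]
      simp [this]
    have hz0 : 0 < ‖g z‖ := norm_pos_iff.2 hz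
    -- Inverting the height function: `‖g z‖ ≤ h s` means `s ≤ c`.
    set c := 2 * M * S * ‖g z‖ ^ (-(1 / (p - 1))) with hc
    have hc0 : 0 < c := by positivity
    have h1 : ∫⁻ s in Ioi (0 : ℝ), Φ s z ≤
        ∫⁻ s in Ioc (0 : ℝ) c, ENNReal.ofReal (4 * ‖g z‖ ^ 2) * ENNReal.ofReal (s ^ (p - 3)) := by
      rw [← lintegral_indicator measurableSet_Ioi, ← lintegral_indicator measurableSet_Ioc]
      refine lintegral_mono fun s => ?_
      by_cases hs : 0 < s
      · by_cases hs2 : ‖g z‖ ≤ h s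
        · have hsc : s ≤ c := by
            have h4 := Real.rpow_le_rpow hz0.le hs2 (by positivity : 0 ≤ 1 / (p - 1))
            rw [hh, ← Real.rpow_mul (by positivity), mul_one_div_cancel hp1.ne',
              Real.rpow_one, le_div_iff₀ hs] at h4
            rw [hc, Real.rpow_neg hz0.le, ← div_eq_mul_inv, le_div_iff₀ (by positivity)]
            linarith
          rw [indicator_of_mem (by exact hs), indicator_of_mem (by exact ⟨hs, hsc⟩)]
          simp only [hΦ]
          rw [indicator_of_mem (by exact hs2), ← ofReal_norm,
            ← ENNReal.ofReal_pow (norm_nonneg _), ← ENNReal.ofReal_mul (by positivity),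
            ← ENNReal.ofReal_mul (by positivity)]
          refine ENNReal.ofReal_le_ofReal (le_of_eq ?_)
          ring
        · rw [indicator_of_mem (by exact hs)]
          simp only [hΦ]
          rw [indicator_of_notMem (by exact hs2)]
          exact zero_le
      · rw [indicator_of_notMem (by exact hs)]
        exact zero_le
    refine h1.trans (le_of_eq ?_)
    rw [lintegral_const_mul' _ _ ENNReal.ofReal_ne_top,
      lintegral_Ioc_ofReal_rpow (by linarith) hc0.le, ← ofReal_norm,
      ENNReal.ofReal_rpow_of_pos hz0, ← ENNReal.ofReal_mul (by positivity),
      ← ENNReal.ofReal_mul (by positivity)]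
    congr 1
    have e2 : p - 3 + 1 = p - 2 := by ring
    have e3 : ‖g z‖ ^ (p / (p - 1)) = ‖g z‖ ^ 2 * (‖g z‖ ^ (-(1 / (p - 1)))) ^ (p - 2) := by
      rw [← Real.rpow_mul hz0.le, ← Real.rpow_two, ← Real.rpow_add hz0]
      congr 1
      field_simp
      ring
    rw [e2, e3, hc, Real.mul_rpow (by positivity) (by positivity)]
    ring
  rw [e1, hlayer]
  calc _ ≤ ENNReal.ofReal p * ∫⁻ s in Ioi (0 : ℝ), ∫⁻ z, Φ s z ∂haar α := by
        gcongr ENNReal.ofReal p * ?_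
        exact setLIntegral_mono' measurableSet_Ioi fun s hs => hpt s hs
    _ = ENNReal.ofReal p * ∫⁻ z, (∫⁻ s in Ioi (0 : ℝ), Φ s z) ∂haar α := by
        rw [lintegral_lintegral_swap hΦm.aemeasurable]
    _ ≤ ENNReal.ofReal p * ∫⁻ z, ENNReal.ofReal (4 * (2 * M * S) ^ (p - 2) / (p - 2)) *
          ‖g z‖ₑ ^ (p / (p - 1)) ∂haar α := by
        gcongr with z
        exact hinner z
    _ = _ := by
        rw [lintegral_const_mul' _ _ ENNReal.ofReal_ne_top, hgS,
          ← ENNReal.ofReal_mul (by positivity), ← ENNReal.ofReal_mul (by linarith)]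
        congr 1
        have e4 : S ^ (p - 1) = S ^ (p - 2) * S := by
          rw [← Real.rpow_add_one hS.ne']
          ring_nf
        rw [e4, Real.mul_rpow (by positivity) hS.le]
        ring

theorem eLpNorm_ofReal_eq {X : Type*} [MeasurableSpace X] (μ : Measure X) {q : ℝ} (hq : 0 < q)
    (f : X → ℂ) :
    eLpNorm f (ENNReal.ofReal q) μ = (∫⁻ x, ‖f x‖ₑ ^ q ∂μ) ^ (1 / q) := by
  rw [eLpNorm_eq_lintegral_rpow_enorm_toReal (by simpa using hq) ENNReal.ofReal_ne_top,
    ENNReal.toReal_ofReal hq.le]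

/-- The Hausdorff–Young inequality for the Fourier–Laguerre transform, up to a constant. -/
theorem exists_eLpNorm_transform_le {α : ℝ} (hα : 0 ≤ α) {p : ℝ} (hp : 2 ≤ p) :
    ∃ C : ℝ, 0 < C ∧ ∀ g : ℝ × ℝ → ℂ, Measurable g → Integrable g (haar α) →
      eLpNorm (transform α g) (ENNReal.ofReal p) (plancherel α) ≤
        ENNReal.ofReal C * eLpNorm g (ENNReal.ofReal (p / (p - 1))) (haar α) := by
  obtain ⟨M, hM0, hM⟩ := exists_norm_phi_le hα
  have hp0 : 0 < p := by linarith
  have hp1 : 0 < p - 1 := by linarith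
  have hq : 0 < p / (p - 1) := by positivity
  -- The interpolation constant blows up as `p` tends to `2`, so the endpoint uses the `L²` bound
  -- itself.
  rcases hp.eq_or_lt with rfl | hp2
  · refine ⟨1, one_pos, fun g hgm hg => ?_⟩
    have h := lintegral_enorm_transform_sq_le hα hgm hg
    have e : (2 : ℝ) / (2 - 1) = 2 := by norm_num
    rw [e, eLpNorm_ofReal_eq _ two_pos, eLpNorm_ofReal_eq _ two_pos, ENNReal.ofReal_one, one_mul]
    gcongr ?_ ^ _
    simpa using h
  have hp2' : 0 < p - 2 := by linarith
  set K := p * (4 * (2 * M) ^ (p - 2) / (p - 2)) with hK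
  have hK0 : 0 < K := by positivity
  refine ⟨K ^ (1 / p), by positivity, fun g hgm hg => ?_⟩
  rw [eLpNorm_ofReal_eq _ hp0, eLpNorm_ofReal_eq _ hq]
  set I := ∫⁻ z, ‖g z‖ₑ ^ (p / (p - 1)) ∂haar α with hI
  rcases eq_or_ne I ⊤ with htop | htop
  · rw [htop, ENNReal.top_rpow_of_pos (by positivity), ENNReal.mul_top]
    · exact le_top
    · simpa using Real.rpow_pos_of_pos hK0 _
  rcases eq_or_ne I 0 with h0 | h0
  · have h1 : g =ᵐ[haar α] 0 := by
      rw [hI, lintegral_eq_zero_iff (hgm.enorm.pow_const _)] at h0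
      filter_upwards [h0] with z hz
      simpa [ENNReal.rpow_eq_zero_iff, hq, hq.le, hq.not_gt] using hz
    rw [transform_congr_ae h1, transform_zero]
    simp [hp0]
  have hS : 0 < I.toReal := ENNReal.toReal_pos h0 htop
  have h := lintegral_enorm_transform_rpow_le hα hM0 hM hp2 hgm hg hS
    (by rw [ENNReal.ofReal_toReal htop])
  rw [← hK] at h
  calc _ ≤ ENNReal.ofReal (K * I.toReal ^ (p - 1)) ^ (1 / p) := by gcongr
    _ = _ := by
      rw [ENNReal.ofReal_rpow_of_pos (by positivity), Real.mul_rpow hK0.le (by positivity),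
        ENNReal.ofReal_mul (by positivity), ← Real.rpow_mul hS.le,
        ← ENNReal.ofReal_rpow_of_pos hS, ENNReal.ofReal_toReal htop]
      congr 2
      field_simp

end

/-! ### Volume of dual balls and local integrability of powers of the norm. -/

section

open Set Filter Topology
open scoped ENNReal

theorem measurable_dualNorm (α : ℝ) : Measurable (dualNorm α) := by
  have h : Measurable fun ξ : ℝ × ℕ => (ξ.2 : ℝ) :=
    (measurable_from_nat (f := fun m : ℕ => (m : ℝ))).comp measurable_snd
  unfold dualNorm
  fun_prop

/-- With `κ = m + (α + 1) / 2`, the slice at `m` is `|l| ≤ R / (4κ)`. Its mass is at most a multiple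
of `L_m^α(0) * (R / κ) ^ (α + 2)`, hence of `R ^ (α + 2) / κ²`, which is summable in `m`. -/
theorem exists_plancherel_dualNorm_le {α : ℝ} (hα : 0 ≤ α) :
    ∃ C : ℝ, 0 < C ∧ ∀ R : ℝ, 0 < R →
      plancherel α {ξ | dualNorm α ξ ≤ R} ≤ ENNReal.ofReal (C * R ^ (α + 2)) := by
  have hsum : Summable fun m : ℕ => 1 / ((m : ℝ) + 1) ^ 2 := by
    have h := (Real.summable_one_div_nat_pow (p := 2)).2 (by norm_num)
    simpa using (summable_nat_add_iff 1).2 h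
  set T := ∑' m : ℕ, 1 / ((m : ℝ) + 1) ^ 2 with hT
  have hT0 : 0 < T := hsum.tsum_pos (fun m => by positivity) 0 (by norm_num)
  set K := 2 * ((1 + α) * 2 ^ α) / 4 ^ (α + 2) * 4 with hK
  have hK0 : 0 < K := by positivity
  refine ⟨K * T, by positivity, fun R hR => ?_⟩
  set E := {ξ : ℝ × ℕ | dualNorm α ξ ≤ R} with hE
  have hEm : MeasurableSet E := measurableSet_le (measurable_dualNorm α) measurable_const
  have hterm : ∀ m : ℕ, ∫⁻ l : ℝ, ENNReal.ofReal (laguerre α m 0 * |l| ^ (α + 1)) *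
      E.indicator 1 (l, m) ≤ ENNReal.ofReal (K * R ^ (α + 2) * (1 / ((m : ℝ) + 1) ^ 2)) := by
    intro m
    have hL := laguerre_zero_pos hα m
    set κ : ℝ := m + (α + 1) / 2 with hκdef
    have hκ : 0 < κ := by positivity
    set ρ := R / (4 * κ) with hρ
    have hρ0 : 0 < ρ := by positivity
    have h1 : ∀ l : ℝ, ENNReal.ofReal (laguerre α m 0 * |l| ^ (α + 1)) *
        E.indicator 1 (l, m) ≤
        (Icc (-ρ) ρ).indicator (fun _ => ENNReal.ofReal (laguerre α m 0 * ρ ^ (α + 1))) l := by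
      intro l
      by_cases hl : (l, m) ∈ E
      · have h2 : |l| ≤ ρ := by
          have h3 : 4 * |l| * κ ≤ R := hl
          rw [hρ, le_div_iff₀ (by positivity)]
          linarith
        rw [indicator_of_mem hl, indicator_of_mem (by exact abs_le.1 h2)]
        simp only [Pi.one_apply, mul_one]
        gcongr
      · rw [indicator_of_notMem hl, mul_zero]
        exact zero_le
    refine (lintegral_mono h1).trans ?_
    rw [lintegral_indicator_const measurableSet_Icc, Real.volume_Icc,
      ← ENNReal.ofReal_mul (by positivity)]
    refine ENNReal.ofReal_le_ofReal ?_
    have e1 : laguerre α m 0 * ρ ^ (α + 1) * (ρ - -ρ) = 2 * laguerre α m 0 * ρ ^ (α + 2) := by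
      have : ρ ^ (α + 2) = ρ ^ (α + 1) * ρ := by
        rw [← Real.rpow_add_one hρ0.ne']
        ring_nf
      rw [this]
      ring
    have e2 : ρ ^ (α + 2) = R ^ (α + 2) / (4 ^ (α + 2) * (κ ^ α * κ ^ 2)) := by
      rw [hρ, Real.div_rpow hR.le (by positivity), Real.mul_rpow (by norm_num) hκ.le,
        Real.rpow_add hκ, Real.rpow_two]
    have h4 : (m + 1 : ℝ) ^ 2 ≤ 4 * κ ^ 2 := by
      have : (m + 1 : ℝ) ≤ 2 * κ := by
        have : (0 : ℝ) ≤ m := by positivity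
        rw [hκdef]
        linarith
      nlinarith [show (0 : ℝ) ≤ m from by positivity]
    have h5 : 1 / κ ^ 2 ≤ 4 * (1 / (m + 1 : ℝ) ^ 2) := by
      rw [mul_one_div, div_le_div_iff₀ (by positivity) (by positivity)]
      linarith
    rw [e1, e2]
    have hκα : 0 < κ ^ α := by positivity
    calc 2 * laguerre α m 0 * (R ^ (α + 2) / (4 ^ (α + 2) * (κ ^ α * κ ^ 2)))
        ≤ 2 * ((1 + α) * 2 ^ α * κ ^ α) * (R ^ (α + 2) / (4 ^ (α + 2) * (κ ^ α * κ ^ 2))) := by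
          gcongr
          exact laguerre_zero_le hα m
      _ = 2 * ((1 + α) * 2 ^ α) / 4 ^ (α + 2) * R ^ (α + 2) * (1 / κ ^ 2) := by
          field_simp
      _ ≤ 2 * ((1 + α) * 2 ^ α) / 4 ^ (α + 2) * R ^ (α + 2) * (4 * (1 / (m + 1 : ℝ) ^ 2)) := by
          gcongr
      _ = _ := by
          rw [hK]
          ring
  have hw : ∀ m : ℕ, Measurable fun l : ℝ =>
      ENNReal.ofReal (laguerre α m 0 * |l| ^ (α + 1)) * E.indicator 1 (l, m) := by
    intro m
    have : Measurable fun l : ℝ => E.indicator (1 : ℝ × ℕ → ℝ≥0∞) (l, m) :=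
      (measurable_one.indicator hEm).comp measurable_prodMk_right
    fun_prop
  rw [← lintegral_indicator_one hEm, lintegral_plancherel α (measurable_one.indicator hEm),
    lintegral_tsum fun m => (hw m).aemeasurable]
  calc _ ≤ ∑' m : ℕ, ENNReal.ofReal (K * R ^ (α + 2) * (1 / ((m : ℝ) + 1) ^ 2)) :=
        ENNReal.tsum_le_tsum hterm
    _ = ENNReal.ofReal (∑' m : ℕ, K * R ^ (α + 2) * (1 / ((m : ℝ) + 1) ^ 2)) :=
        (ENNReal.ofReal_tsum_of_nonneg (fun m => by positivity) (hsum.mul_left _)).symm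
    _ = _ := by
        rw [tsum_mul_left, ← hT]
        ring_nf

theorem ae_pos_radialMeasure (α : ℝ) : ∀ᵐ x ∂radialMeasure α, 0 < x := by
  refine (withDensity_absolutelyContinuous _ _).ae_le ?_
  rw [← Measure.restrict_congr_set (Ioi_ae_eq_Ici (a := (0 : ℝ)) (μ := volume))]
  exact self_mem_ae_restrict measurableSet_Ioi

theorem ae_haar (α : ℝ) : ∀ᵐ z ∂haar α, 0 < z.1 ∧ z.2 ≠ 0 := by
  rw [haar_eq_prod]
  have h2 : ∀ᵐ t : ℝ, t ≠ 0 := by simp [ae_iff]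
  exact (Measure.quasiMeasurePreserving_fst.ae (ae_pos_radialMeasure α)).and
    (Measure.quasiMeasurePreserving_snd.ae h2)

theorem measurable_homNorm : Measurable homNorm := by
  unfold homNorm
  fun_prop

theorem homNorm_pow_four (z : ℝ × ℝ) : homNorm z ^ 4 = z.1 ^ 4 + 4 * z.2 ^ 2 := by
  rw [homNorm, ← Real.rpow_natCast, ← Real.rpow_mul (by positivity)]
  norm_num

theorem homNorm_nonneg (z : ℝ × ℝ) : 0 ≤ homNorm z := by
  unfold homNorm
  positivity

theorem le_homNorm (z : ℝ × ℝ) : z.1 ≤ homNorm z := by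
  refine le_of_pow_le_pow_left₀ four_ne_zero (homNorm_nonneg z) ?_
  rw [homNorm_pow_four]
  nlinarith [sq_nonneg z.2]

theorem abs_le_homNorm_sq (z : ℝ × ℝ) : |z.2| ≤ homNorm z ^ 2 := by
  refine le_of_pow_le_pow_left₀ two_ne_zero (by positivity) ?_
  rw [← pow_mul, homNorm_pow_four, sq_abs]
  nlinarith [sq_nonneg z.2, sq_nonneg (z.1 ^ 2)]

theorem lintegral_radialMeasure_Ioc_rpow {α c r : ℝ} (hα : 0 ≤ α) (hc : c < 2 * α + 2)
    (hr : 0 < r) :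
    ∫⁻ x, (Ioc 0 r).indicator (fun x => ENNReal.ofReal (x ^ (-c))) x ∂radialMeasure α =
      ENNReal.ofReal ((Real.pi * Real.Gamma (α + 1))⁻¹ *
        (r ^ (2 * α + 2 - c) / (2 * α + 2 - c))) := by
  have hΓ : 0 < Real.Gamma (α + 1) := Real.Gamma_pos_of_pos (by positivity)
  have hπ := Real.pi_pos
  have hm : Measurable ((Ioc 0 r).indicator fun x : ℝ => ENNReal.ofReal (x ^ (-c))) :=
    Measurable.indicator (by fun_prop) measurableSet_Ioc
  rw [radialMeasure, lintegral_withDensity_eq_lintegral_mul _ (measurable_radialDensity α) hm]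
  have h1 : ∀ x : ℝ, ((fun x : ℝ =>
        ENNReal.ofReal (x ^ (2 * α + 1) / (Real.pi * Real.Gamma (α + 1)))) *
      (Ioc 0 r).indicator fun x => ENNReal.ofReal (x ^ (-c))) x =
      (Ioc 0 r).indicator (fun x => ENNReal.ofReal ((Real.pi * Real.Gamma (α + 1))⁻¹) *
        ENNReal.ofReal (x ^ (2 * α + 1 - c))) x := by
    intro x
    by_cases hx : x ∈ Ioc 0 r
    · have hx0 := hx.1
      rw [Pi.mul_apply, indicator_of_mem hx, indicator_of_mem hx,
        ← ENNReal.ofReal_mul (by positivity), ← ENNReal.ofReal_mul (by positivity),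
        sub_eq_add_neg (2 * α + 1), Real.rpow_add hx0 (2 * α + 1)]
      congr 1
      rw [div_eq_mul_inv]
      ac_rfl
    · rw [Pi.mul_apply, indicator_of_notMem hx, indicator_of_notMem hx, mul_zero]
  simp_rw [h1]
  rw [lintegral_indicator measurableSet_Ioc, Measure.restrict_restrict measurableSet_Ioc,
    inter_eq_left.2 (fun x hx => hx.1.le), lintegral_const_mul' _ _ ENNReal.ofReal_ne_top,
    lintegral_Ioc_ofReal_rpow (by linarith) hr.le, ← ENNReal.ofReal_mul (by positivity)]
  congr 3 <;> ring_nf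

/-- Polar coordinates are avoided: `|z| ≥ x` and `|z|² ≥ |t|` give `|z| ^ (-s) ≤ x ^ (-c₁) * |t| ^
(-c₂)` when `s = c₁ + 2c₂`, and the integral over the enclosing box factors. -/
theorem exists_lintegral_homNorm_rpow_le {α : ℝ} (hα : 0 ≤ α) {s : ℝ} (hs : 0 < s)
    (hsQ : s < homDim α) :
    ∃ C : ℝ, 0 < C ∧ ∀ r : ℝ, 0 < r →
      ∫⁻ z, {z | homNorm z < r}.indicator (fun z => ENNReal.ofReal (homNorm z ^ (-s))) z ∂haar α ≤
        ENNReal.ofReal (C * r ^ (homDim α - s)) := by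
  have hQ : 0 < homDim α := by
    unfold homDim
    positivity
  have hΓ : 0 < Real.Gamma (α + 1) := Real.Gamma_pos_of_pos (by positivity)
  -- The exponent is shared in proportion to `Q = (2α + 2) + 2`, so `s < Q` yields both `c₂ < 1` and
  -- `c₁ < 2α + 2`.
  set c₂ := s / homDim α with hc₂
  set c₁ := c₂ * (2 * α + 2) with hc₁
  have h2 : c₂ < 1 := (div_lt_one hQ).2 hsQ
  have h20 : 0 < c₂ := by positivity
  have h10 : 0 < c₁ := by positivity
  have h1 : c₁ < 2 * α + 2 := by
    rw [hc₁]
    nlinarith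
  have hs12 : s = c₁ + 2 * c₂ := by
    have : s = c₂ * homDim α := by
      rw [hc₂]
      field_simp
    rw [this, hc₁, homDim]
    ring
  have hd1 : 0 < 2 * α + 2 - c₁ := by linarith
  have hd2 : 0 < 1 - c₂ := by linarith
  refine ⟨(Real.pi * Real.Gamma (α + 1))⁻¹ / (2 * α + 2 - c₁) * (2 / (1 - c₂)),
    by positivity, fun r hr => ?_⟩
  set U : ℝ → ℝ≥0∞ := (Ioc 0 (r ^ 2)).indicator fun t => ENNReal.ofReal (t ^ (-c₂)) with hU
  set V : ℝ → ℝ≥0∞ := (Ioc 0 r).indicator fun x => ENNReal.ofReal (x ^ (-c₁)) with hV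
  have hUm : Measurable U := Measurable.indicator (by fun_prop) measurableSet_Ioc
  have hVm : Measurable V := Measurable.indicator (by fun_prop) measurableSet_Ioc
  have hUint : ∫⁻ t, U t = ENNReal.ofReal ((r ^ 2) ^ (1 - c₂) / (1 - c₂)) := by
    rw [hU, lintegral_indicator measurableSet_Ioc, lintegral_Ioc_ofReal_rpow (by linarith)
      (by positivity)]
    rw [neg_add_eq_sub]
  have hUneg : ∫⁻ t, U (-t) = ∫⁻ t, U t := lintegral_neg_eq_self U
  have hle : ∀ᵐ z ∂haar α,
      {z | homNorm z < r}.indicator (fun z => ENNReal.ofReal (homNorm z ^ (-s))) z ≤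
        V z.1 * (U z.2 + U (-z.2)) := by
    filter_upwards [ae_haar α] with z hz
    by_cases hzr : homNorm z < r
    · rw [indicator_of_mem (by exact hzr)]
      have hx := le_homNorm z
      have ht := abs_le_homNorm_sq z
      have hn : 0 < homNorm z := hz.1.trans_le hx
      have ht0 : 0 < |z.2| := abs_pos.2 hz.2
      have htr : |z.2| ≤ r ^ 2 := ht.trans (by gcongr)
      have hVz : V z.1 = ENNReal.ofReal (z.1 ^ (-c₁)) :=
        indicator_of_mem (by exact ⟨hz.1, hx.trans hzr.le⟩) _
      have hUz : ENNReal.ofReal (|z.2| ^ (-c₂)) ≤ U z.2 + U (-z.2) := by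
        rcases abs_choice z.2 with h | h
        · refine le_add_of_le_of_nonneg (le_of_eq ?_) zero_le
          rw [hU, indicator_of_mem (by rw [← h]; exact ⟨ht0, htr⟩), h]
        · refine le_add_of_nonneg_of_le zero_le (le_of_eq ?_)
          rw [hU, indicator_of_mem (by rw [← h]; exact ⟨ht0, htr⟩), h]
      rw [hVz]
      refine le_trans ?_ (mul_le_mul_right hUz _)
      have := hz.1
      rw [← ENNReal.ofReal_mul (by positivity)]
      refine ENNReal.ofReal_le_ofReal ?_
      have e : homNorm z ^ (-s) = homNorm z ^ (-c₁) * (homNorm z ^ 2) ^ (-c₂) := by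
        rw [← Real.rpow_two, ← Real.rpow_mul hn.le, ← Real.rpow_add hn, hs12]
        congr 1
        ring
      rw [e]
      exact mul_le_mul (Real.rpow_le_rpow_of_nonpos hz.1 hx (by linarith))
        (Real.rpow_le_rpow_of_nonpos ht0 ht (by linarith)) (by positivity) (by positivity)
    · rw [indicator_of_notMem (by exact hzr)]
      exact zero_le
  refine (lintegral_mono_ae hle).trans (le_of_eq ?_)
  rw [haar_eq_prod, lintegral_prod_mul (g := fun t => U t + U (-t)) hVm.aemeasurable
    (hUm.add (hUm.comp measurable_neg)).aemeasurable,
    lintegral_add_left hUm, hUneg, hUint, hV, lintegral_radialMeasure_Ioc_rpow hα h1 hr,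
    ← ENNReal.ofReal_add (by positivity) (by positivity), ← ENNReal.ofReal_mul (by positivity)]
  congr 1
  have e : r ^ (homDim α - s) = r ^ (2 * α + 2 - c₁) * (r ^ 2) ^ (1 - c₂) := by
    rw [← Real.rpow_two, ← Real.rpow_mul hr.le, ← Real.rpow_add hr, hs12, homDim]
    congr 1
    ring
  rw [e]
  ring

end

/-! ### Low and high frequencies, and the choice of the radius. -/

section

open Set Filter Topology
open scoped ENNReal SchwartzMap

theorem integrable_schwartz_haar {α : ℝ} (hα : 0 ≤ α) (f : 𝓢(ℝ × ℝ, ℂ)) :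
    Integrable f (haar α) := by
  have hΓ : 0 < Real.Gamma (α + 1) := Real.Gamma_pos_of_pos (by positivity)
  have hπ := Real.pi_pos
  have hd : Measurable fun z : ℝ × ℝ =>
      ENNReal.ofReal (z.1 ^ (2 * α + 1) / (Real.pi * Real.Gamma (α + 1))) :=
    (measurable_radialDensity α).comp measurable_fst
  rw [haar, integrable_withDensity_iff_integrable_smul' hd
    (Eventually.of_forall fun _ => ENNReal.ofReal_lt_top)]
  set n := ⌈2 * α + 1⌉₊ with hn
  set K := (Real.pi * Real.Gamma (α + 1))⁻¹ with hK
  have hK0 : 0 < K := by positivity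
  have hdom : Integrable (fun z => K * (‖f z‖ + ‖z‖ ^ n * ‖f z‖))
      ((volume : Measure (ℝ × ℝ)).restrict carrier) :=
    ((f.integrable.norm.add (f.integrable_pow_mul volume n)).const_mul K).restrict
  refine hdom.mono' ?_ ?_
  · exact (hd.ennreal_toReal.smul f.continuous.measurable).aestronglyMeasurable
  · have hc : MeasurableSet carrier := measurableSet_Ici.prod MeasurableSet.univ
    filter_upwards [self_mem_ae_restrict hc] with z hz
    have hz1 : 0 ≤ z.1 := hz.1
    have h1 : z.1 ^ (2 * α + 1) ≤ 1 + ‖z‖ ^ n := by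
      have hzn : z.1 ≤ ‖z‖ := (le_abs_self _).trans (norm_fst_le z)
      rcases le_total z.1 1 with h | h
      · exact (Real.rpow_le_one hz1 h (by positivity)).trans (by simp)
      · calc z.1 ^ (2 * α + 1) ≤ z.1 ^ (n : ℝ) := Real.rpow_le_rpow_of_exponent_le h (Nat.le_ceil _)
          _ = z.1 ^ n := Real.rpow_natCast _ _
          _ ≤ ‖z‖ ^ n := by gcongr
          _ ≤ _ := by simp
    rw [norm_smul, ENNReal.toReal_ofReal (by positivity), Real.norm_eq_abs,
      abs_of_nonneg (by positivity)]
    calc z.1 ^ (2 * α + 1) / (Real.pi * Real.Gamma (α + 1)) * ‖f z‖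
        ≤ (1 + ‖z‖ ^ n) / (Real.pi * Real.Gamma (α + 1)) * ‖f z‖ := by gcongr
      _ = _ := by
        rw [hK]
        ring

theorem ae_dualNorm_pos {α : ℝ} (hα : 0 ≤ α) : ∀ᵐ ξ ∂plancherel α, 0 < dualNorm α ξ := by
  refine (withDensity_absolutelyContinuous _ _).ae_le ?_
  have h2 : ∀ᵐ l : ℝ, l ≠ 0 := by simp [ae_iff]
  filter_upwards [Measure.quasiMeasurePreserving_fst.ae h2] with ξ hξ
  have := abs_pos.2 hξ
  unfold dualNorm
  positivity

variable {α p a b : ℝ}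

/-- Hölder's inequality on the ball of radius `r` against the weight `|z| ^ a`. -/
theorem exists_lintegral_ball_le (hα : 0 ≤ α) (hp : 2 ≤ p) (ha : 0 < a)
    (haQ : a < homDim α / p) :
    ∃ C : ℝ, 0 < C ∧ ∀ r : ℝ, 0 < r → ∀ f : ℝ × ℝ → ℂ, Measurable f →
      ∫⁻ z, ‖{z | homNorm z < r}.indicator f z‖ₑ ∂haar α ≤
        ENNReal.ofReal (C * r ^ (homDim α / p - a)) *
          eLpNorm (fun z => ((homNorm z ^ a : ℝ) : ℂ) * f z) (ENNReal.ofReal (p / (p - 1)))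
            (haar α) := by
  have hp0 : 0 < p := by linarith
  have hp1 : 0 < p - 1 := by linarith
  have hq : 0 < p / (p - 1) := by positivity
  have hsQ : a * p < homDim α := (lt_div_iff₀ hp0).1 haQ
  obtain ⟨C, hC, h⟩ := exists_lintegral_homNorm_rpow_le hα (s := a * p) (by positivity) hsQ
  refine ⟨C ^ (1 / p), by positivity, fun r hr f hf => ?_⟩
  have hpq : p.HolderConjugate (p / (p - 1)) := Real.HolderConjugate.conjExponent (by linarith)
  set B := {z | homNorm z < r} with hB
  have hBm : MeasurableSet B := measurableSet_lt measurable_homNorm measurable_const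
  -- The `p`-th power of this factor is `|z| ^ (-a p)` on the ball, integrable because `a p < Q`.
  set u : ℝ × ℝ → ℝ≥0∞ := B.indicator fun z => ENNReal.ofReal (homNorm z ^ (-a)) with hu
  have hhm := measurable_homNorm
  have hum : Measurable u := Measurable.indicator (by fun_prop) hBm
  have h1 : ∫⁻ z, ‖B.indicator f z‖ₑ ∂haar α ≤
      ∫⁻ z, (u * fun z => ‖((homNorm z ^ a : ℝ) : ℂ) * f z‖ₑ) z ∂haar α := by
    refine lintegral_mono_ae ?_
    filter_upwards [ae_haar α] with z hz
    have hn : 0 < homNorm z := hz.1.trans_le (le_homNorm z)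
    by_cases hzB : z ∈ B
    · rw [indicator_of_mem hzB, Pi.mul_apply, hu, indicator_of_mem hzB, enorm_mul, ← mul_assoc,
        ← ofReal_norm ((homNorm z ^ a : ℝ) : ℂ), Complex.norm_real, Real.norm_eq_abs,
        abs_of_nonneg (by positivity), ← ENNReal.ofReal_mul (by positivity), ← Real.rpow_add hn]
      simp
    · rw [indicator_of_notMem hzB]
      simp
  refine h1.trans ((ENNReal.lintegral_mul_le_Lp_mul_Lq _ hpq hum.aemeasurable
    (by fun_prop)).trans ?_)
  rw [eLpNorm_ofReal_eq _ hq]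
  gcongr
  have h2 : ∀ z, u z ^ p = B.indicator (fun z => ENNReal.ofReal (homNorm z ^ (-(a * p)))) z := by
    intro z
    by_cases hzB : z ∈ B
    · rw [hu, indicator_of_mem hzB, indicator_of_mem hzB,
        ENNReal.ofReal_rpow_of_nonneg (Real.rpow_nonneg (homNorm_nonneg z) _) hp0.le,
        ← Real.rpow_mul (homNorm_nonneg z), neg_mul]
    · rw [hu, indicator_of_notMem hzB, indicator_of_notMem hzB, ENNReal.zero_rpow_of_pos hp0]
  simp_rw [h2]
  calc _ ≤ ENNReal.ofReal (C * r ^ (homDim α - a * p)) ^ (1 / p) := by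
        gcongr
        exact h r hr
    _ = _ := by
        rw [ENNReal.ofReal_rpow_of_pos (by positivity), Real.mul_rpow hC.le (by positivity),
          ← Real.rpow_mul hr.le]
        congr 3
        field_simp

/-- The transform at low frequencies is controlled by the weighted norm of `f`. -/
theorem exists_eLpNorm_indicator_transform_le (hα : 0 ≤ α) (hp : 2 ≤ p) (ha : 0 < a)
    (haQ : a < homDim α / p) :
    ∃ C : ℝ, 0 < C ∧ ∀ R : ℝ, 0 < R → ∀ f : ℝ × ℝ → ℂ, Measurable f → Integrable f (haar α) →
      eLpNorm ({ξ | dualNorm α ξ ≤ R}.indicator (transform α f)) (ENNReal.ofReal p)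
          (plancherel α) ≤
        ENNReal.ofReal (C * R ^ (a / 2)) *
          eLpNorm (fun z => ((homNorm z ^ a : ℝ) : ℂ) * f z) (ENNReal.ofReal (p / (p - 1)))
            (haar α) := by
  have hp0 : 0 < p := by linarith
  obtain ⟨M, hM0, hM⟩ := exists_norm_phi_le hα
  obtain ⟨C₁, hC₁, h₁⟩ := exists_lintegral_ball_le hα hp ha haQ
  obtain ⟨C₂, hC₂, h₂⟩ := exists_plancherel_dualNorm_le hα
  obtain ⟨C₃, hC₃, h₃⟩ := exists_eLpNorm_transform_le hα hp
  refine ⟨M * C₁ * C₂ ^ (1 / p) + C₃, by positivity, fun R hR f hfm hf => ?_⟩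
  set A := eLpNorm (fun z => ((homNorm z ^ a : ℝ) : ℂ) * f z) (ENNReal.ofReal (p / (p - 1)))
            (haar α) with hA
  -- The dual quasi-norm scales as an inverse square of length, so this radius matches `R` and makes
  -- both pieces of size `R ^ (a / 2)`.
  set r := R ^ (-(1 / 2) : ℝ) with hr
  have hr0 : 0 < r := by positivity
  set B := {z | homNorm z < r} with hB
  have hBm : MeasurableSet B := measurableSet_lt measurable_homNorm measurable_const
  set E := {ξ | dualNorm α ξ ≤ R} with hE
  have hEm : MeasurableSet E := measurableSet_le (measurable_dualNorm α) measurable_const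
  set f₁ := B.indicator f with hf₁
  set f₂ := Bᶜ.indicator f with hf₂
  have hf₁m : Measurable f₁ := hfm.indicator hBm
  have hf₂m : Measurable f₂ := hfm.indicator hBm.compl
  have hf₁i : Integrable f₁ (haar α) := hf.indicator hBm
  have hf₂i : Integrable f₂ (haar α) := hf.indicator hBm.compl
  have hsum : transform α f = transform α f₁ + transform α f₂ := by
    funext ξ
    rw [Pi.add_apply, ← transform_add hα hf₁i hf₂i, hf₁, hf₂, indicator_self_add_compl]
  have hlow : eLpNorm (E.indicator (transform α f₁)) (ENNReal.ofReal p) (plancherel α) ≤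
      ENNReal.ofReal (M * C₁ * C₂ ^ (1 / p) * R ^ (a / 2)) * A := by
    set D := ENNReal.ofReal M * (ENNReal.ofReal (C₁ * r ^ (homDim α / p - a)) * A) with hD
    have hpt : ∀ ξ, ‖E.indicator (transform α f₁) ξ‖ₑ ^ p ≤ E.indicator (fun _ => D ^ p) ξ := by
      intro ξ
      by_cases hξ : ξ ∈ E
      · rw [indicator_of_mem hξ, indicator_of_mem hξ]
        gcongr
        refine (enorm_transform_le hM f₁ ξ).trans ?_
        rw [hD]
        gcongr
        exact h₁ r hr0 f hfm
      · rw [indicator_of_notMem hξ, indicator_of_notMem hξ, enorm_zero,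
          ENNReal.zero_rpow_of_pos hp0]
    rw [eLpNorm_ofReal_eq _ hp0]
    calc _ ≤ (∫⁻ ξ, E.indicator (fun _ => D ^ p) ξ ∂plancherel α) ^ (1 / p) := by
          gcongr with ξ
          exact hpt ξ
      _ = D * plancherel α E ^ (1 / p) := by
          rw [lintegral_indicator_const hEm, ENNReal.mul_rpow_of_nonneg _ _ (by positivity),
            ← ENNReal.rpow_mul, mul_one_div_cancel hp0.ne', ENNReal.rpow_one]
      _ ≤ D * ENNReal.ofReal (C₂ * R ^ (α + 2)) ^ (1 / p) := by
          gcongr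
          exact h₂ R hR
      _ = _ := by
          rw [hD, ← mul_assoc, mul_right_comm, ENNReal.ofReal_rpow_of_pos (by positivity),
            ← ENNReal.ofReal_mul (by positivity), ← ENNReal.ofReal_mul (by positivity)]
          congr 2
          -- The powers `R ^ (∓Q / (2p))` cancel because `α + 2 = Q / 2`.
          have e : r ^ (homDim α / p - a) * (R ^ (α + 2)) ^ (1 / p) = R ^ (a / 2) := by
            rw [hr, ← Real.rpow_mul hR.le, ← Real.rpow_mul hR.le, ← Real.rpow_add hR, homDim]
            congr 1
            field_simp
            ring
          rw [Real.mul_rpow hC₂.le (by positivity), ← e]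
          ring
  have hhigh : eLpNorm (E.indicator (transform α f₂)) (ENNReal.ofReal p) (plancherel α) ≤
      ENNReal.ofReal (C₃ * R ^ (a / 2)) * A := by
    have h4 : eLpNorm f₂ (ENNReal.ofReal (p / (p - 1))) (haar α) ≤
        ENNReal.ofReal (R ^ (a / 2)) * A := by
      refine eLpNorm_le_mul_eLpNorm_of_ae_le_mul (Eventually.of_forall fun z => ?_) _
      by_cases hz : z ∈ Bᶜ
      · have hrz : r ≤ homNorm z := not_lt.1 hz
        have h5 : 1 ≤ R ^ (a / 2) * homNorm z ^ a := by
          have h6 : r ^ a ≤ homNorm z ^ a := by gcongr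
          have h7 : R ^ (a / 2) * r ^ a = 1 := by
            rw [hr, ← Real.rpow_mul hR.le, ← Real.rpow_add hR]
            ring_nf
            simp
          rw [← h7]
          gcongr
        rw [hf₂, indicator_of_mem hz, norm_mul, Complex.norm_real, Real.norm_eq_abs,
          abs_of_nonneg (Real.rpow_nonneg (homNorm_nonneg z) _), ← mul_assoc]
        exact le_mul_of_one_le_left (norm_nonneg _) h5
      · rw [hf₂, indicator_of_notMem hz, norm_zero]
        positivity
    calc _ ≤ eLpNorm (transform α f₂) (ENNReal.ofReal p) (plancherel α) :=
          eLpNorm_indicator_le _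
      _ ≤ ENNReal.ofReal C₃ * (ENNReal.ofReal (R ^ (a / 2)) * A) :=
          (h₃ f₂ hf₂m hf₂i).trans (by gcongr)
      _ = _ := by rw [← mul_assoc, ← ENNReal.ofReal_mul hC₃.le]
  rw [hsum, indicator_add']
  refine (eLpNorm_add_le
    ((stronglyMeasurable_transform α hf₁m).aestronglyMeasurable.indicator hEm)
    ((stronglyMeasurable_transform α hf₂m).aestronglyMeasurable.indicator hEm) ?_).trans ?_
  · rw [ENNReal.one_le_ofReal]
    linarith
  · refine (add_le_add hlow hhigh).trans (le_of_eq ?_)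
    rw [← add_mul, ← ENNReal.ofReal_add (by positivity) (by positivity), ← add_mul]

theorem eLpNorm_indicator_transform_compl_le (hb : 0 < b) {R : ℝ} (hR : 0 < R) (q : ℝ≥0∞)
    (F : ℝ × ℕ → ℂ) :
    eLpNorm ({ξ | dualNorm α ξ ≤ R}ᶜ.indicator F) q (plancherel α) ≤
      ENNReal.ofReal (R ^ (-(b / 2))) *
        eLpNorm (fun ξ => ((dualNorm α ξ ^ (b / 2) : ℝ) : ℂ) * F ξ) q (plancherel α) := by
  refine eLpNorm_le_mul_eLpNorm_of_ae_le_mul (Eventually.of_forall fun ξ => ?_) _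
  by_cases hξ : ξ ∈ {ξ | dualNorm α ξ ≤ R}ᶜ
  · have h : R < dualNorm α ξ := not_le.1 hξ
    have h0 : 0 ≤ dualNorm α ξ := hR.le.trans h.le
    have h1 : 1 ≤ R ^ (-(b / 2)) * dualNorm α ξ ^ (b / 2) := by
      rw [Real.rpow_neg hR.le, ← div_eq_inv_mul, one_le_div (by positivity)]
      gcongr
    rw [indicator_of_mem hξ, norm_mul, Complex.norm_real, Real.norm_eq_abs,
      abs_of_nonneg (by positivity), ← mul_assoc]
    exact le_mul_of_one_le_left (norm_nonneg _) h1
  · rw [indicator_of_notMem hξ, norm_zero]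
    positivity

/-- Optimization of a two-term estimate over the free parameter. -/
theorem rpow_le_mul_of_forall_le (ha : 0 < a) (hb : 0 < b) {C A B : ℝ} (hC : 0 < C) (hA : 0 < A)
    (hB : 0 < B) {N : ℝ≥0∞}
    (h : ∀ R : ℝ, 0 < R → N ≤ ENNReal.ofReal (C * R ^ (a / 2) * A + R ^ (-(b / 2)) * B)) :
    N ^ (a + b) ≤ ENNReal.ofReal ((C + 1) ^ (a + b) * A ^ b * B ^ a) := by
  have hab : a + b ≠ 0 := by positivity
  set D := A ^ (b / (a + b)) * B ^ (a / (a + b)) with hD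
  have hD0 : 0 < D := by positivity
  -- At this `R`, apart from the factor `C`, both terms equal the geometric mean `D`.
  have h1 := h ((B / A) ^ (2 / (a + b))) (by positivity)
  have e1 : ((B / A) ^ (2 / (a + b))) ^ (a / 2) * A = D := by
    have hA1 : A = A ^ (a / (a + b)) * A ^ (b / (a + b)) := by
      rw [← Real.rpow_add hA, ← add_div, div_self hab, Real.rpow_one]
    have e : 2 / (a + b) * (a / 2) = a / (a + b) := by field_simp
    rw [← Real.rpow_mul (by positivity), e, Real.div_rpow hB.le hA.le, hD]
    rw [div_mul_eq_mul_div, div_eq_iff (by positivity)]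
    linear_combination B ^ (a / (a + b)) * hA1
  have e2 : ((B / A) ^ (2 / (a + b))) ^ (-(b / 2)) * B = D := by
    have hB1 : B = B ^ (a / (a + b)) * B ^ (b / (a + b)) := by
      rw [← Real.rpow_add hB, ← add_div, div_self hab, Real.rpow_one]
    have e : 2 / (a + b) * (-(b / 2)) = -(b / (a + b)) := by field_simp
    rw [← Real.rpow_mul (by positivity), e, Real.rpow_neg (by positivity),
      Real.div_rpow hB.le hA.le, hD, inv_div, div_mul_eq_mul_div, div_eq_iff (by positivity)]
    linear_combination A ^ (b / (a + b)) * hB1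
  have e3 : C * ((B / A) ^ (2 / (a + b))) ^ (a / 2) * A +
      ((B / A) ^ (2 / (a + b))) ^ (-(b / 2)) * B = (C + 1) * D := by
    rw [mul_assoc, e1, e2]
    ring
  rw [e3] at h1
  calc N ^ (a + b) ≤ ENNReal.ofReal ((C + 1) * D) ^ (a + b) := by gcongr
    _ = _ := by
      rw [ENNReal.ofReal_rpow_of_pos (by positivity), Real.mul_rpow (by positivity) hD0.le, hD,
        Real.mul_rpow (by positivity) (by positivity), ← Real.rpow_mul hA.le,
        ← Real.rpow_mul hB.le, div_mul_cancel₀ _ hab, div_mul_cancel₀ _ hab, mul_assoc]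

end

end LaguerreHypergroup

/-! ### The uncertainty inequality. -/

theorem theorem1p6 (α : ℝ) (hα : 0 ≤ α) (p a b : ℝ) (hp : 2 ≤ p)
    (ha : 0 < a) (haQ : a < LaguerreHypergroup.homDim α / p) (hb : 0 < b) (hb4 : b < 4) :
    ∃ c : ℝ, 0 < c ∧ ∀ f ∈ LaguerreHypergroup.schwartzSpace,
      eLpNorm (LaguerreHypergroup.transform α f) (ENNReal.ofReal p)
          (LaguerreHypergroup.plancherel α) ^ (a + b) ≤
        ENNReal.ofReal c *
          eLpNorm (fun z => ((LaguerreHypergroup.homNorm z ^ a : ℝ) : ℂ) * f z)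
              (ENNReal.ofReal (p / (p - 1))) (LaguerreHypergroup.haar α) ^ b *
          eLpNorm (fun ξ => ((LaguerreHypergroup.dualNorm α ξ ^ (b / 2) : ℝ) : ℂ) *
                LaguerreHypergroup.transform α f ξ)
              (ENNReal.ofReal p) (LaguerreHypergroup.plancherel α) ^ a := by
  open LaguerreHypergroup in
  have hp0 : 0 < p := by linarith
  have hp1 : 0 < p - 1 := by linarith
  have hq : 0 < p / (p - 1) := by positivity
  obtain ⟨C, hC, hlow⟩ := exists_eLpNorm_indicator_transform_le hα hp ha haQ
  refine ⟨(C + 1) ^ (a + b), by positivity, fun f _ => ?_⟩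
  have hfi := integrable_schwartz_haar hα f
  have hfm : Measurable f := f.continuous.measurable
  have hTm := stronglyMeasurable_transform α hfm
  have hhm := measurable_homNorm
  have hdm := measurable_dualNorm α
  set A := eLpNorm (fun z => ((homNorm z ^ a : ℝ) : ℂ) * f z)
    (ENNReal.ofReal (p / (p - 1))) (haar α) with hA
  set B := eLpNorm (fun ξ => ((dualNorm α ξ ^ (b / 2) : ℝ) : ℂ) * transform α f ξ)
    (ENNReal.ofReal p) (plancherel α) with hB
  set N := eLpNorm (transform α f) (ENNReal.ofReal p) (plancherel α) with hN
  have hc0 : ENNReal.ofReal ((C + 1) ^ (a + b)) ≠ 0 := by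
    simpa using Real.rpow_pos_of_pos (by positivity : 0 < C + 1) _
  have hN0 : N = 0 → N ^ (a + b) = 0 := fun h => by
    rw [h, ENNReal.zero_rpow_of_pos (by positivity)]
  -- Vanishing norms come first: either one forces the transform to vanish almost everywhere.
  -- Afterwards an infinite norm makes the right side `⊤`, with no product `0 * ⊤` (which is `0`)
  -- left to arise.
  rcases eq_or_ne A 0 with hA0 | hA0
  · have h1 := (eLpNorm_eq_zero_iff (by fun_prop) (by simpa using hq)).1 (hA.symm.trans hA0)
    have h2 : f =ᵐ[haar α] 0 := by
      filter_upwards [h1, ae_haar α] with z hz hz'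
      have hn : 0 < homNorm z := hz'.1.trans_le (le_homNorm z)
      have : ((homNorm z ^ a : ℝ) : ℂ) ≠ 0 :=
        Complex.ofReal_ne_zero.2 (Real.rpow_pos_of_pos hn _).ne'
      exact (mul_eq_zero.1 hz).resolve_left this
    rw [hN0 (by rw [hN, transform_congr_ae h2, transform_zero, eLpNorm_zero])]
    exact zero_le
  rcases eq_or_ne B 0 with hB0 | hB0
  · have h1 := (eLpNorm_eq_zero_iff (((hdm.pow_const _).complex_ofReal.mul
      hTm.measurable).aestronglyMeasurable) (by simpa using hp0)).1 (hB.symm.trans hB0)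
    have h2 : transform α f =ᵐ[plancherel α] 0 := by
      filter_upwards [h1, ae_dualNorm_pos hα] with ξ hξ hξ'
      have : ((dualNorm α ξ ^ (b / 2) : ℝ) : ℂ) ≠ 0 :=
        Complex.ofReal_ne_zero.2 (Real.rpow_pos_of_pos hξ' _).ne'
      exact (mul_eq_zero.1 hξ).resolve_left this
    rw [hN0 (by rw [hN, eLpNorm_congr_ae h2, eLpNorm_zero])]
    exact zero_le
  rcases eq_or_ne A ⊤ with hAt | hAt
  · rw [hAt, ENNReal.top_rpow_of_pos hb, ENNReal.mul_top hc0, ENNReal.top_mul]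
    · exact le_top
    · simp [ENNReal.rpow_eq_zero_iff, hB0, ha.not_gt]
  rcases eq_or_ne B ⊤ with hBt | hBt
  · rw [hBt, ENNReal.top_rpow_of_pos ha, ENNReal.mul_top]
    · exact le_top
    · exact mul_ne_zero hc0 (by simp [ENNReal.rpow_eq_zero_iff, hA0, hb.not_gt])
  have hA' := ENNReal.toReal_pos hA0 hAt
  have hB' := ENNReal.toReal_pos hB0 hBt
  have key : ∀ R : ℝ, 0 < R →
      N ≤ ENNReal.ofReal (C * R ^ (a / 2) * A.toReal + R ^ (-(b / 2)) * B.toReal) := by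
    intro R hR
    have hEm : MeasurableSet {ξ | dualNorm α ξ ≤ R} := measurableSet_le hdm measurable_const
    have h1 := eLpNorm_add_le (p := ENNReal.ofReal p) (μ := plancherel α)
      (hTm.aestronglyMeasurable.indicator hEm) (hTm.aestronglyMeasurable.indicator hEm.compl)
      (by rw [ENNReal.one_le_ofReal]; linarith)
    rw [Set.indicator_self_add_compl] at h1
    refine h1.trans ((add_le_add (hlow R hR f hfm hfi)
      (eLpNorm_indicator_transform_compl_le hb hR _ _)).trans (le_of_eq ?_))
    rw [ENNReal.ofReal_add (by positivity) (by positivity),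
      ENNReal.ofReal_mul (p := C * R ^ (a / 2)) (by positivity),
      ENNReal.ofReal_mul (p := R ^ (-(b / 2))) (by positivity),
      ENNReal.ofReal_toReal hAt, ENNReal.ofReal_toReal hBt]
  refine (rpow_le_mul_of_forall_le ha hb hC hA' hB' key).trans (le_of_eq ?_)
  rw [ENNReal.ofReal_mul (by positivity), ENNReal.ofReal_mul (by positivity),
    ← ENNReal.ofReal_rpow_of_pos hA', ← ENNReal.ofReal_rpow_of_pos hB',
    ENNReal.ofReal_toReal hAt, ENNReal.ofReal_toReal hBt]
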